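/- Let $W=W_{-1}\oplus W_0\oplus W_1$ be the complex graded vector space with homogeneous basis $e_1,e_2,e_3$ of degrees $|e_1|=0$, $|e_2|=-1$, $|e_3|=1$, so that $W$ has $\mathbb Z_2$-graded dimension $1|2$. Let $S(W)$ be its graded symmetric coalgebra. A $\mathbb Z$-graded (resp. $\mathbb Z_2$-graded) codifferential is an odd coderivation $d$ of $S(W)$ with $d(1)=0$ and $d^2=0$ that has degree $1$ (resp. is odd). Write $d\sim d'$ if $d'=g^*(d):=g^{-1}dg$ for a coalgebra automorphism $g$ of $S(W)$ of degree $0$ (resp. even). The moduli space is the set of equivalence classes. Let $C^k$ be the space of coderivations whose components $S^r(W)\to W$ vanish for all $r\neq k$, and let $C^k_1\subset C^k$ be the subspace of those of $\mathbb Z$-degree $1$. A linear automorphism $\lambda$ is one with $\lambda(w_1\cdots w_n)=\lambda(w_1)\cdots\lambda(w_n)$. A one-parameter family of deformations of $d$ is a map $t\mapsto d(t)$ from $\mathbb C$ to codifferentials with $d(0)=d$, whose matrix entries in the monomial basis are all holomorphic on a common disc around $0$. It is a jump to $d'$ if $d(t)\sim d'$ for all small $t\ne0$, and a smooth family if it is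 not a jump to any $d'$. There is a jump deformation from $d$ to $d'$ if $d\not\sim d'$ and some family of deformations of $d$ is a jump to $d'$. A family $d(t)$ of deformations of $d$ factors through a jump deformation if there are a jump deformation from $d$ to some $d'$ and a family $d'(t)$ of deformations of $d'$ with $d'(t)\sim d(t)$ for all small $t\neq0$. Each of these notions has a $\mathbb Z$-graded and a $\mathbb Z_2$-graded version. Then: 1. The natural map from the $\mathbb Z$-graded moduli space to the $\mathbb Z_2$-graded moduli space is a bijection. 2. For every $k$ and every $\mathbb Z_2$-graded codifferential $d\in C^k$ there is an even linear automorphism $g$ with $g^*(d)\in C^k_1$. 3. Let $k\ge1$, let $0\ne d\in C^k_1$, and let $g$ be an even linear automorphism. Then $g^*(d)$ has $\mathbb Z$-degree $1$ if and only if the coefficient of $e_2$ in $g(e_3)$ is $0$. In this case there is a linear automorphism $g_0$ of degree $0$ with the same diagonal coefficients as $g$ in the basis $e_1,e_2,e_3$ such that $g_0^*(d)=g^*(d)$. 4. The deformations agree. For every $\mathbb Z$-graded codifferential $d$: (a) every $\mathbb Z$-graded family of deformations of $d$ is a $\mathbb Z_2$-graded one; it is a smooth family in the $\mathbb Z$-graded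 sense iff it is one in the $\mathbb Z_2$-graded sense, and it factors through a jump deformation in the $\mathbb Z$-graded sense iff it does so in the $\mathbb Z_2$-graded sense; (b) for every $\mathbb Z_2$-graded family $D(t)$ of deformations of $d$ there is a $\mathbb Z$-graded family $E(t)$ of deformations of $d$ such that $E(t)$ and $D(t)$ are equivalent as $\mathbb Z_2$-graded codifferentials for all $t$ near $0$; (c) for every $\mathbb Z$-graded codifferential $d'$, there is a $\mathbb Z$-graded jump deformation from $d$ to $d'$ iff there is a $\mathbb Z_2$-graded one. -/

import Mathlib

open scoped TensorProduct Topology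

noncomputable section

/-! ### The graded symmetric coalgebra `S(W)` of `W = W₋₁ ⊕ W₀ ⊕ W₁`

`W` has the homogeneous basis `e₁, e₂, e₃` with `|e₁| = 0`, `|e₂| = -1`, `|e₃| = 1`;
so `e₁` is even and `e₂, e₃` are odd, and `W` has dimension `1|2`. -/

namespace LInfty

/-- The triple `(i, j, k)` stands for the monomial `e₁ ^ i * e₂ ^ j * e₃ ^ k`.
The odd generators `e₂, e₃` have exponent at most one. -/
abbrev Mon : Type := ℕ × Fin 2 × Fin 2

/-- The number of factors of a monomial: `m ∈ S^r(W)` with `r = weight m`. -/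
def Mon.weight (m : Mon) : ℕ := m.1 + m.2.1.val + m.2.2.val

/-- The `ℤ`-degree of a monomial. -/
def Mon.deg (m : Mon) : ℤ := (m.2.2.val : ℤ) - (m.2.1.val : ℤ)

/-- The basis vectors of `W`, as monomials. -/
def m₁ : Mon := (1, 0, 0)
def m₂ : Mon := (0, 1, 0)
def m₃ : Mon := (0, 0, 1)

/-- The underlying vector space of `S(W)`: the complex vector space spanned by the monomials. -/
def SW : Type := Mon →₀ ℂ

instance : AddCommGroup SW := inferInstanceAs (AddCommGroup (Mon →₀ ℂ))
instance : Module ℂ SW := inferInstanceAs (Module ℂ (Mon →₀ ℂ))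

/-- The standard basis of `S(W)`. -/
def mono : Module.Basis Mon ℂ SW := Finsupp.basisSingleOne

/-- The coefficient of the monomial `m'` in `f m`. -/
def entry (f : SW →ₗ[ℂ] SW) (m' m : Mon) : ℂ := mono.repr (f (mono m)) m'

/-- The graded commutative product of `S(W)`:
`e₁^i e₂^j e₃^k * e₁^i' e₂^j' e₃^k' = (-1)^(k j') e₁^(i+i') e₂^(j+j') e₃^(k+k')`,
which is zero as soon as an odd generator would appear twice. -/
def mulSW : SW →ₗ[ℂ] SW →ₗ[ℂ] SW :=
  mono.constr ℂ fun m => mono.constr ℂ fun n =>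
    if m.2.1.val + n.2.1.val ≤ 1 ∧ m.2.2.val + n.2.2.val ≤ 1 then
      ((-1 : ℂ) ^ (m.2.2.val * n.2.1.val)) •
        mono (m.1 + n.1, m.2.1 + n.2.1, m.2.2 + n.2.2)
    else 0

/-- The ways to distribute `j ≤ 1` odd factors over two places. -/
def splits (j : Fin 2) : Finset (Fin 2 × Fin 2) :=
  Finset.univ.filter fun p => p.1.val + p.2.val = j.val

/-- The (unshuffle) coproduct of `S(W)`, determined by `Δ w = w ⊗ 1 + 1 ⊗ w` for `w ∈ W` and
by multiplicativity, with the Koszul sign of moving `e₃^c` past `e₂^b'`. -/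
def comulSW : SW →ₗ[ℂ] SW ⊗[ℂ] SW :=
  mono.constr ℂ fun m =>
    ∑ a ∈ Finset.HasAntidiagonal.antidiagonal m.1, ∑ b ∈ splits m.2.1, ∑ c ∈ splits m.2.2,
      ((m.1.choose a.1 : ℂ) * (-1 : ℂ) ^ (b.2.val * c.1.val)) •
        (mono (a.1, b.1, c.1) ⊗ₜ[ℂ] mono (a.2, b.2, c.2))

/-- The counit of `S(W)`: the coefficient of the monomial `1`. -/
def counitSW : SW →ₗ[ℂ] ℂ := mono.constr ℂ fun m => if m = 0 then 1 else 0

theorem comulSW_mono (m : Mon) : comulSW (mono m) =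
    ∑ a ∈ Finset.HasAntidiagonal.antidiagonal m.1, ∑ b ∈ splits m.2.1, ∑ c ∈ splits m.2.2,
      ((m.1.choose a.1 : ℂ) * (-1 : ℂ) ^ (b.2.val * c.1.val)) •
        (mono (a.1, b.1, c.1) ⊗ₜ[ℂ] mono (a.2, b.2, c.2)) := by
  simp only [comulSW, Module.Basis.constr_basis]

theorem counitSW_mono (m : Mon) : counitSW (mono m) = if m = 0 then 1 else 0 := by
  simp only [counitSW, Module.Basis.constr_basis]

theorem splits_zero : splits 0 = {(0, 0)} := by decide

theorem splits_one : splits 1 = {(0, 1), (1, 0)} := by decide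

theorem sum_choose_assoc {M : Type*} [AddCommGroup M] [Module ℂ M] (n : ℕ)
    (F : ℕ → ℕ → ℕ → M) :
    ∑ p ∈ Finset.HasAntidiagonal.antidiagonal n, ∑ q ∈ Finset.HasAntidiagonal.antidiagonal p.1,
        ((n.choose p.1 : ℂ) * (p.1.choose q.1 : ℂ)) • F q.1 q.2 p.2 =
      ∑ p ∈ Finset.HasAntidiagonal.antidiagonal n, ∑ q ∈ Finset.HasAntidiagonal.antidiagonal p.2,
        ((n.choose p.1 : ℂ) * (p.2.choose q.1 : ℂ)) • F p.1 q.1 q.2 := by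
  rw [Finset.sum_sigma', Finset.sum_sigma']
  refine Finset.sum_nbij' (fun x => ⟨(x.2.1, x.2.2 + x.1.2), (x.2.2, x.1.2)⟩)
    (fun x => ⟨(x.1.1 + x.2.1, x.2.2), (x.1.1, x.2.1)⟩) ?_ ?_ ?_ ?_ ?_
  · rintro ⟨⟨a, b⟩, ⟨c, d⟩⟩ h
    simp only [Finset.mem_sigma, Finset.HasAntidiagonal.mem_antidiagonal] at h ⊢
    exact ⟨by omega, trivial⟩
  · rintro ⟨⟨a, b⟩, ⟨c, d⟩⟩ h
    simp only [Finset.mem_sigma, Finset.HasAntidiagonal.mem_antidiagonal] at h ⊢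
    exact ⟨by omega, trivial⟩
  · rintro ⟨⟨a, b⟩, ⟨c, d⟩⟩ h
    simp only [Finset.mem_sigma, Finset.HasAntidiagonal.mem_antidiagonal] at h
    obtain ⟨h1, rfl⟩ := h
    rfl
  · rintro ⟨⟨a, b⟩, ⟨c, d⟩⟩ h
    simp only [Finset.mem_sigma, Finset.HasAntidiagonal.mem_antidiagonal] at h
    obtain ⟨h1, rfl⟩ := h
    rfl
  · rintro ⟨⟨a, b⟩, ⟨c, d⟩⟩ h
    simp only [Finset.mem_sigma, Finset.HasAntidiagonal.mem_antidiagonal] at h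
    obtain ⟨rfl, rfl⟩ := h
    have := Nat.choose_mul (n := c + d + b) (k := c + d) (s := c) (by omega)
    have e1 : c + d + b - c = d + b := by omega
    have e2 : c + d - c = d := by omega
    rw [e1, e2] at this
    simp only
    congr 1
    exact_mod_cast this

/-- The graded symmetric coalgebra `S(W)`. -/
instance : Coalgebra ℂ SW where
  comul := comulSW
  counit := counitSW
  coassoc := by
    refine mono.ext ?_
    rintro ⟨i, j, k⟩
    have key := fun x y z : Fin 2 × Fin 2 => sum_choose_assoc i
      (fun a b c => mono (a, x) ⊗ₜ[ℂ] (mono (b, y) ⊗ₜ[ℂ] mono (c, z)))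
    fin_cases j <;> fin_cases k <;>
      simp [comulSW_mono, splits_zero, splits_one, map_sum, TensorProduct.sum_tmul,
        TensorProduct.tmul_sum, TensorProduct.add_tmul, TensorProduct.tmul_add,
        TensorProduct.neg_tmul, TensorProduct.tmul_neg,
        ← TensorProduct.smul_tmul', smul_smul, Finset.sum_add_distrib, Finset.smul_sum, key]
    all_goals abel
  rTensor_counit_comp_comul := by
    refine mono.ext ?_
    rintro ⟨i, j, k⟩
    fin_cases j <;> fin_cases k <;>
      · simp [comulSW_mono, counitSW_mono, splits_zero, splits_one, map_sum]
        rw [Finset.sum_eq_single (0, i)]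
        · simp
        · rintro ⟨a, b⟩ hb hne
          have h0 : a ≠ 0 := by
            rintro rfl
            simp at hb
            simp [hb] at hne
          simp [h0]
        · simp
  lTensor_counit_comp_comul := by
    refine mono.ext ?_
    rintro ⟨i, j, k⟩
    fin_cases j <;> fin_cases k <;>
      · simp [comulSW_mono, counitSW_mono, splits_zero, splits_one, map_sum]
        rw [Finset.sum_eq_single (i, 0)]
        · simp
        · rintro ⟨a, b⟩ hb hne
          have h0 : b ≠ 0 := by
            rintro rfl
            simp at hb
            simp [hb] at hne
          simp [h0]
        · simp

/-! ### Gradings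

Both gradings are treated at once: `A = ℤ` gives the `ℤ`-grading of `S(W)`, and `A = ZMod 2` gives
the `ℤ₂`-grading that it induces. Signs depend only on the parity. -/

/-- The linear map `f` is homogeneous of degree `n` for the `A`-grading of `S(W)`. -/
def HasDegree (A : Type) [Ring A] (f : SW →ₗ[ℂ] SW) (n : A) : Prop :=
  ∀ m m' : Mon, entry f m' m ≠ 0 → ((m'.deg : ℤ) : A) = ((m.deg : ℤ) : A) + n

open Classical in
/-- The projection of `S(W)` to its part of degree `a`. -/
def proj (A : Type) [Ring A] (a : A) : SW →ₗ[ℂ] SW :=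
  mono.constr ℂ fun m => if ((m.deg : ℤ) : A) = a then mono m else 0

theorem proj_mono (A : Type) [Ring A] (a : A) (m : Mon) [Decidable (((m.deg : ℤ) : A) = a)] :
    proj A a (mono m) = if ((m.deg : ℤ) : A) = a then mono m else 0 := by
  simp only [proj, Module.Basis.constr_basis]
  congr

open Classical in
theorem repr_proj (A : Type) [Ring A] (a : A) (x : SW) (m : Mon) :
    mono.repr (proj A a x) m = if ((m.deg : ℤ) : A) = a then mono.repr x m else 0 := by
  suffices H : Finsupp.lapply m ∘ₗ (mono.repr : SW →ₗ[ℂ] (Mon →₀ ℂ)) ∘ₗ proj A a =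
      (if ((m.deg : ℤ) : A) = a then (1 : ℂ) else 0) •
        (Finsupp.lapply m ∘ₗ (mono.repr : SW →ₗ[ℂ] (Mon →₀ ℂ))) by
    have := LinearMap.congr_fun H x
    simp only [LinearMap.comp_apply, LinearMap.smul_apply, Finsupp.lapply_apply,
      LinearEquiv.coe_coe, smul_eq_mul, ite_mul, one_mul, zero_mul] at this
    exact this
  refine mono.ext fun n => ?_
  simp only [LinearMap.comp_apply, LinearMap.smul_apply, proj_mono]
  by_cases h : n = m
  · subst h
    split_ifs <;> simp
  · split_ifs <;> simp [h]

theorem hasDegree_zero_iff (A : Type) [Ring A] (f : SW →ₗ[ℂ] SW) :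
    HasDegree A f 0 ↔ ∀ (a : A) (x : SW), proj A a (f x) = f (proj A a x) := by
  classical
  constructor
  · intro h a
    suffices H : (proj A a) ∘ₗ f = f ∘ₗ proj A a from fun x => LinearMap.congr_fun H x
    refine mono.ext fun m => ?_
    refine mono.repr.injective (Finsupp.ext fun m' => ?_)
    have hm := h m m'
    simp only [LinearMap.comp_apply, repr_proj, proj_mono, entry, add_zero] at hm ⊢
    by_cases h0 : (mono.repr (f (mono m))) m' = 0
    · split_ifs <;> simp [h0]
    · rw [hm h0]
      split_ifs <;> simp
  · intro h m m' hne
    by_contra hd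
    apply hne
    have h1 := h ((m.deg : ℤ) : A) (mono m)
    rw [proj_mono, if_pos rfl] at h1
    rw [entry, ← h1, repr_proj, if_neg]
    simpa using hd

theorem HasDegree.cast {A : Type} [Ring A] {f : SW →ₗ[ℂ] SW} {n : ℤ}
    (h : HasDegree ℤ f n) : HasDegree A f (n : A) := by
  intro m m' hne
  have := h m m' hne
  simp only [Int.cast_id] at this
  rw [this]
  push_cast
  rfl

/-! ### Automorphisms, coderivations, codifferentials -/

/-- A coalgebra automorphism of `S(W)` as a linear map. -/
def lin (g : SW ≃ₗc[ℂ] SW) : SW →ₗ[ℂ] SW := (g.toLinearEquiv : SW →ₗ[ℂ] SW)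

/-- The action of automorphisms: `g^*(d) = g⁻¹ d g`. -/
def pull (g : SW ≃ₗc[ℂ] SW) (d : SW →ₗ[ℂ] SW) : SW →ₗ[ℂ] SW := lin g.symm ∘ₗ d ∘ₗ lin g

/-- A linear automorphism of `S(W)`: `λ(w₁ ⋯ wₙ) = λ(w₁) ⋯ λ(wₙ)`. -/
def IsLinearAut (g : SW ≃ₗc[ℂ] SW) : Prop :=
  ∀ u v : SW, lin g (mulSW u v) = mulSW (lin g u) (lin g v)

/-- The parity involution `u ↦ (-1)^|u| u` of `S(W)`. -/
def parity : SW →ₗ[ℂ] SW :=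
  mono.constr ℂ fun m => ((-1 : ℂ) ^ (m.2.1.val + m.2.2.val)) • mono m

/-- The co-Leibniz rule of an odd coderivation, `Δ d = (d ⊗ 1 + 1 ⊗ d) Δ`, where by the Koszul rule
`(1 ⊗ d)(u ⊗ v) = (-1)^|u| u ⊗ d v`. -/
def IsOddCoderivation (d : SW →ₗ[ℂ] SW) : Prop :=
  Coalgebra.comul ∘ₗ d =
    (TensorProduct.map d LinearMap.id + TensorProduct.map parity d) ∘ₗ
      (Coalgebra.comul : SW →ₗ[ℂ] SW ⊗[ℂ] SW)

/-- The coderivation `d` lies in `C^k = Hom(S^k(W), W)`: its component `S^r(W) → W` vanishes for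
all `r ≠ k`. -/
def IsCochain (k : ℕ) (d : SW →ₗ[ℂ] SW) : Prop :=
  ∀ m m' : Mon, m.weight ≠ k → m'.weight = 1 → entry d m' m = 0

/-- The codifferentials on `S(W)`, that is, the `L∞` structures, for the grading by `A`: coderivations
of degree `1` and of square zero. By `d 1 = 0` there is no component `S^0(W) → W`, that is,
`d = d₁ + d₂ + ⋯`. -/
structure Codiff (A : Type) [Ring A] where
  toMap : SW →ₗ[ℂ] SW
  isCoder : IsOddCoderivation toMap
  map_one : toMap (mono 0) = 0
  hasDegree : HasDegree A toMap 1
  sq_zero : toMap ∘ₗ toMap = 0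

/-- `d ∼ d'`: some automorphism `g` of `S(W)` of degree `0` has `g^*(d) = d'`. -/
def Codiff.Equivalent {A : Type} [Ring A] (d d' : Codiff A) : Prop :=
  ∃ g : SW ≃ₗc[ℂ] SW, HasDegree A (lin g) 0 ∧ d'.toMap = pull g d.toMap

theorem lin_symm_lin (g : SW ≃ₗc[ℂ] SW) (x : SW) : lin g.symm (lin g x) = x :=
  g.symm_apply_apply x

theorem lin_lin_symm (g : SW ≃ₗc[ℂ] SW) (x : SW) : lin g (lin g.symm x) = x :=
  g.apply_symm_apply x

theorem hasDegree_symm {A : Type} [Ring A] {g : SW ≃ₗc[ℂ] SW} (h : HasDegree A (lin g) 0) :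
    HasDegree A (lin g.symm) 0 := by
  rw [hasDegree_zero_iff] at h ⊢
  intro a x
  have := h a (lin g.symm x)
  rw [lin_lin_symm] at this
  rw [this, lin_symm_lin]

theorem Codiff.equivalence (A : Type) [Ring A] :
    Equivalence (Codiff.Equivalent (A := A)) where
  refl d := by
    refine ⟨CoalgEquiv.refl ℂ SW, ?_, ?_⟩
    · rw [hasDegree_zero_iff]
      intro a x
      rfl
    · rfl
  symm := by
    rintro d d' ⟨g, hg, h⟩
    refine ⟨g.symm, hasDegree_symm hg, ?_⟩
    ext x
    have e : lin g.symm.symm = lin g := rfl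
    simp only [h, pull, LinearMap.comp_apply, e, lin_lin_symm]
  trans := by
    rintro d d' d'' ⟨g, hg, h⟩ ⟨g', hg', h'⟩
    refine ⟨g'.trans g, ?_, ?_⟩
    · rw [hasDegree_zero_iff] at hg hg' ⊢
      intro a x
      have e : ∀ y, lin (g'.trans g) y = lin g (lin g' y) := fun y => rfl
      rw [e, e, hg, hg']
    · rw [h', h]
      rfl

/-- The moduli space: equivalence classes of codifferentials. -/
def Codiff.setoid (A : Type) [Ring A] : Setoid (Codiff A) := ⟨_, Codiff.equivalence A⟩

def Moduli (A : Type) [Ring A] : Type := Quotient (Codiff.setoid A)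

/-- A `ℤ`-graded codifferential, regarded as a `ℤ₂`-graded one. -/
def Codiff.forget (d : Codiff ℤ) : Codiff (ZMod 2) where
  toMap := d.toMap
  isCoder := d.isCoder
  map_one := d.map_one
  hasDegree := by simpa using d.hasDegree.cast (A := ZMod 2)
  sq_zero := d.sq_zero

theorem Codiff.Equivalent.forget {d d' : Codiff ℤ} (h : d.Equivalent d') :
    d.forget.Equivalent d'.forget := by
  obtain ⟨g, hg, h⟩ := h
  exact ⟨g, by simpa using hg.cast (A := ZMod 2), h⟩

/-- The natural map from the `ℤ`-graded to the `ℤ₂`-graded moduli space. -/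
def moduliMap : Moduli ℤ → Moduli (ZMod 2) :=
  Quotient.map (sa := Codiff.setoid ℤ) (sb := Codiff.setoid (ZMod 2)) Codiff.forget
    fun _ _ h => h.forget

/-! ### Deformations -/

/-- A one-parameter family of deformations of `d`: a curve `D` of codifferentials that is
holomorphic near `0`, with `D 0 = d`. Only the values of `D` near `0` matter. -/
def IsDeformation {A : Type} [Ring A] (d : Codiff A) (D : ℂ → Codiff A) : Prop :=
  D 0 = d ∧ ∃ r : ℝ, 0 < r ∧ ∀ m m' : Mon,
    DifferentiableOn ℂ (fun t => entry (D t).toMap m' m) (Metric.ball 0 r)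

/-- The family `D` is a jump to `d'`: `D t ∼ d'` for all small `t ≠ 0`. -/
def JumpsTo {A : Type} [Ring A] (D : ℂ → Codiff A) (d' : Codiff A) : Prop :=
  ∀ᶠ t in 𝓝[≠] (0 : ℂ), (D t).Equivalent d'

/-- A smooth family of deformations: one that is not a jump to any codifferential. -/
def IsSmoothFamily {A : Type} [Ring A] (D : ℂ → Codiff A) : Prop :=
  ¬ ∃ d', JumpsTo D d'

/-- There is a (nontrivial) jump deformation from `d` to `d'`. -/
def HasJump {A : Type} [Ring A] (d d' : Codiff A) : Prop :=
  ¬ d.Equivalent d' ∧ ∃ D, IsDeformation d D ∧ JumpsTo D d'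

/-- The family `D` of deformations of `d` factors through a jump deformation from `d`
to some `d'`: it agrees, up to equivalence and for small `t ≠ 0`, with a family of deformations
of `d'`. -/
def FactorsThroughJump {A : Type} [Ring A] (d : Codiff A) (D : ℂ → Codiff A) : Prop :=
  ∃ d', HasJump d d' ∧ ∃ D', IsDeformation d' D' ∧
    ∀ᶠ t in 𝓝[≠] (0 : ℂ), (D' t).Equivalent (D t)

end LInfty

end

/-!
The linear functionals on `S(W)` form the algebra of functions on a formal supermanifold with one
even coordinate `x` and two odd ones `θ₂`, `θ₃`: a functional is a quadruple of power series in `x`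
(`taylor`), and the transpose of the coproduct is the product of such functions (`taylor_conv`).
An odd coderivation becomes an odd vector field
`d = (a θ₂ + b θ₃) ∂/∂x + (p + q θ₂ θ₃) ∂/∂θ₂ + (r + s θ₂ θ₃) ∂/∂θ₃`
(`represents_fieldOf`), which has `ℤ`-degree one iff `b = p = q = 0`. The equation `d² = 0`
reads
`a p + b r = 0`, `a q + b s = a' b - b' a`, `p' a = q r`, `r' a = s r`, `p' b = -q p`,
`r' b = -s p`.

The part of `ℤ`-degree one of a codifferential `d` is again one (`Codiff.part`). If
`p = f r`, `b = -f a` and `q = f s + f' a` for a power series `f`, the automorphism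
`θ₂ ↦ θ₂ + f θ₃` carries `d` to this part (`Represents.comp_shearMap`). Such an `f` exists as
soon as, in the first nonzero one of the pairs `(r, p)`, `(a, b)`, `(s, q)`, the second series is
a multiple of the first: the other relations then follow from `d² = 0`
(`Represents.exists_isStraightenedBy`). Replacing `θ₃` by `θ₃ - t θ₂` for a suitable constant `t`
achieves the divisibility. So every `ℤ₂`-graded codifferential is equivalent to a `ℤ`-graded one,
and in the homogeneous case `f` may be taken constant (`IsCochain.isStraightenedBy_C`).

For a holomorphic family, a single constant `t` serves all small nonzero parameters, by the identity
theorem applied to the first coefficients that do not vanish identically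
(`exists_tilt_of_family`). As the automorphisms `θ₃ ↦ θ₃ + κ θ₂` commute with the vector fields
of degree one, passing to the new coordinates and then to the part of degree one does not move a
`ℤ`-graded codifferential, and it keeps the family holomorphic: this turns a `ℤ₂`-graded family
of deformations into a `ℤ`-graded one, equivalent at every parameter (`IsDeformation.exists_int`).

Conversely, let an even automorphism `g` carry a nonzero vector field of degree one to another one.
Then the image of `θ₂` under `g` is a multiple of `θ₂` (`series_two_three_eq_zero`), and a further
`θ₃ ↦ θ₃ + κ θ₂` makes the image of `θ₃` a multiple of `θ₃`; the resulting automorphism has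
`ℤ`-degree zero and acts on the given vector field in the same way (`hasDegree_straighten`,
`pull_straighten`). So even equivalence implies equivalence in degree zero
(`Codiff.equivalent_of_forget`), and the statements on jumps and smooth families follow formally.
-/

noncomputable section

namespace LInfty

open PowerSeries

/-! ### Functions on the formal supermanifold dual to `S(W)` -/

/-- A function `c + y θ₂ + z θ₃ + w θ₂ θ₃` on the formal supermanifold with the even coordinate `x`
and the odd coordinates `θ₂, θ₃` (dual to `e₁, e₂, e₃`); the coefficients are power series in
`x`. -/
@[ext] structure SuperFun where
  c : ℂ⟦X⟧
  y : ℂ⟦X⟧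
  z : ℂ⟦X⟧
  w : ℂ⟦X⟧

/-- The product of superfunctions, with `θ₃ θ₂ = -θ₂ θ₃`. -/
def SuperFun.mul (u v : SuperFun) : SuperFun :=
  ⟨u.c * v.c, u.c * v.y + u.y * v.c, u.c * v.z + u.z * v.c,
    u.c * v.w + u.y * v.z - u.z * v.y + u.w * v.c⟩

/-- The parity involution `u ↦ (-1)^|u| u` of superfunctions. -/
def SuperFun.par (u : SuperFun) : SuperFun := ⟨u.c, -u.y, -u.z, u.w⟩

/-- The power series `∑ ξ(e₁ⁿ e₂ʲ e₃ᵏ) xⁿ / n!`. -/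
def series (ξ : SW →ₗ[ℂ] ℂ) (j k : Fin 2) : ℂ⟦X⟧ :=
  PowerSeries.mk fun n => ξ (mono (n, j, k)) / (n.factorial : ℂ)

/-- A linear functional on `S(W)`, seen as a superfunction. As `Δ e₁ⁿ` has binomial coefficients,
the functional dual to `e₁ⁿ` is `xⁿ / n!`. -/
def taylor (ξ : SW →ₗ[ℂ] ℂ) : SuperFun :=
  ⟨series ξ 0 0, series ξ 1 0, series ξ 0 1, series ξ 1 1⟩

/-- The product of linear functionals on `S(W)` that is dual to the coproduct. -/
def conv (ξ ζ : SW →ₗ[ℂ] ℂ) : SW →ₗ[ℂ] ℂ :=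
  LinearMap.mul' ℂ ℂ ∘ₗ TensorProduct.map ξ ζ ∘ₗ Coalgebra.comul

theorem coeff_series (ξ : SW →ₗ[ℂ] ℂ) (j k : Fin 2) (n : ℕ) :
    coeff n (series ξ j k) = ξ (mono (n, j, k)) / (n.factorial : ℂ) := by
  simp [series]

theorem apply_mono_eq (ξ : SW →ₗ[ℂ] ℂ) (j k : Fin 2) (n : ℕ) :
    ξ (mono (n, j, k)) = n.factorial * coeff n (series ξ j k) := by
  have : (n.factorial : ℂ) ≠ 0 := by exact_mod_cast n.factorial_ne_zero
  rw [coeff_series]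
  field_simp

theorem taylor_injective : Function.Injective taylor := by
  intro ξ ζ h
  refine mono.ext ?_
  rintro ⟨n, j, k⟩
  rw [SuperFun.ext_iff] at h
  obtain ⟨h1, h2, h3, h4⟩ := h
  simp only [taylor] at h1 h2 h3 h4
  fin_cases j <;> fin_cases k <;> simp_all [apply_mono_eq]

theorem taylor_surjective : Function.Surjective taylor := by
  rintro ⟨c, y, z, w⟩
  refine ⟨mono.constr ℂ fun m => (m.1.factorial : ℂ) * coeff m.1
    (if m.2.1 = 0 then if m.2.2 = 0 then c else z else if m.2.2 = 0 then y else w), ?_⟩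
  have h : ∀ n : ℕ, (n.factorial : ℂ) ≠ 0 := fun n => by exact_mod_cast n.factorial_ne_zero
  ext n <;> simp [taylor, coeff_series, h]

theorem series_add (ξ ζ : SW →ₗ[ℂ] ℂ) (j k : Fin 2) :
    series (ξ + ζ) j k = series ξ j k + series ζ j k := by
  ext n; simp [coeff_series, add_div]

theorem series_smul (t : ℂ) (ξ : SW →ₗ[ℂ] ℂ) (j k : Fin 2) :
    series (t • ξ) j k = C t * series ξ j k := by
  ext n; simp [coeff_series, mul_div_assoc]

theorem conv_mono (ξ ζ : SW →ₗ[ℂ] ℂ) (m : Mon) : conv ξ ζ (mono m) =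
    ∑ a ∈ Finset.HasAntidiagonal.antidiagonal m.1, ∑ b ∈ splits m.2.1, ∑ c ∈ splits m.2.2,
      ((m.1.choose a.1 : ℂ) * (-1 : ℂ) ^ (b.2.val * c.1.val)) *
        (ξ (mono (a.1, b.1, c.1)) * ζ (mono (a.2, b.2, c.2))) := by
  change LinearMap.mul' ℂ ℂ (TensorProduct.map ξ ζ (comulSW (mono m))) = _
  simp [comulSW_mono, map_sum]

theorem choose_mul_div_factorial {n a b : ℕ} (h : a + b = n) (p q : ℂ) :
    (n.choose a : ℂ) * (p * q) / (n.factorial : ℂ) =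
      p / (a.factorial : ℂ) * (q / (b.factorial : ℂ)) := by
  subst h
  have h : ∀ n : ℕ, (n.factorial : ℂ) ≠ 0 := fun n => by exact_mod_cast n.factorial_ne_zero
  have := Nat.add_choose_mul_factorial_mul_factorial a b
  have h2 : ((a + b).choose a : ℂ) * a.factorial * b.factorial = (a + b).factorial := by
    rw [Nat.choose_symm_add]
    exact_mod_cast this
  rw [div_mul_div_comm, div_eq_div_iff (h _) (mul_ne_zero (h _) (h _)), ← h2]
  ring

theorem coeff_series_mul (ξ ζ : SW →ₗ[ℂ] ℂ) (j k j' k' : Fin 2) (n : ℕ) :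
    coeff n (series ξ j k * series ζ j' k') =
      (∑ a ∈ Finset.HasAntidiagonal.antidiagonal n, (n.choose a.1 : ℂ) *
        (ξ (mono (a.1, j, k)) * ζ (mono (a.2, j', k')))) / (n.factorial : ℂ) := by
  rw [coeff_mul, Finset.sum_div]
  refine Finset.sum_congr rfl fun a ha => ?_
  rw [choose_mul_div_factorial (Finset.HasAntidiagonal.mem_antidiagonal.mp ha), coeff_series,
    coeff_series]

theorem taylor_conv (ξ ζ : SW →ₗ[ℂ] ℂ) :
    taylor (conv ξ ζ) = (taylor ξ).mul (taylor ζ) := by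
  ext n <;>
  · simp only [taylor, SuperFun.mul, map_add, map_sub, coeff_series_mul]
    rw [coeff_series, conv_mono]
    simp [splits_zero, splits_one, Finset.sum_add_distrib, add_div]
    try ring

theorem taylor_comp_parity (ξ : SW →ₗ[ℂ] ℂ) : taylor (ξ ∘ₗ parity) = (taylor ξ).par := by
  ext n <;> simp [taylor, SuperFun.par, coeff_series, parity, neg_div]

/-! ### Linear maps on `S(W)` and their transposes -/

/-- Linear maps into `S(W)` agree as soon as all linear functionals agree on them. -/
theorem ext_functional {f g : SW →ₗ[ℂ] SW} (h : ∀ ξ : SW →ₗ[ℂ] ℂ, ξ ∘ₗ f = ξ ∘ₗ g) : f = g := by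
  ext x
  refine mono.ext_elem fun m => ?_
  exact LinearMap.congr_fun (h (mono.coord m)) x

theorem ext_taylor {f g : SW →ₗ[ℂ] SW} (h : ∀ ξ, taylor (ξ ∘ₗ f) = taylor (ξ ∘ₗ g)) : f = g :=
  ext_functional fun ξ => taylor_injective (h ξ)

theorem ext_tensor {f g : SW →ₗ[ℂ] SW ⊗[ℂ] SW}
    (h : ∀ ξ ζ : SW →ₗ[ℂ] ℂ, LinearMap.mul' ℂ ℂ ∘ₗ TensorProduct.map ξ ζ ∘ₗ f =
      LinearMap.mul' ℂ ℂ ∘ₗ TensorProduct.map ξ ζ ∘ₗ g) : f = g := by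
  have key : ∀ (m n : Mon) (t : SW ⊗[ℂ] SW), (mono.tensorProduct mono).repr t (m, n) =
      LinearMap.mul' ℂ ℂ (TensorProduct.map (mono.coord m) (mono.coord n) t) := by
    intro m n t
    induction t with
    | zero => simp
    | tmul x y => simp [mul_comm]
    | add x y hx hy => simp [hx, hy]
  ext x
  refine (mono.tensorProduct mono).ext_elem fun p => ?_
  rw [key, key]
  exact LinearMap.congr_fun (h _ _) x

theorem conv_comp_map (ξ ζ : SW →ₗ[ℂ] ℂ) (f g : SW →ₗ[ℂ] SW) :
    LinearMap.mul' ℂ ℂ ∘ₗ TensorProduct.map ξ ζ ∘ₗ TensorProduct.map f g ∘ₗ Coalgebra.comul =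
      conv (ξ ∘ₗ f) (ζ ∘ₗ g) := by
  rw [conv, TensorProduct.map_comp, LinearMap.comp_assoc]

theorem isOddCoderivation_iff (d : SW →ₗ[ℂ] SW) : IsOddCoderivation d ↔
    ∀ ξ ζ : SW →ₗ[ℂ] ℂ, conv ξ ζ ∘ₗ d = conv (ξ ∘ₗ d) ζ + conv (ξ ∘ₗ parity) (ζ ∘ₗ d) := by
  have key : ∀ ξ ζ : SW →ₗ[ℂ] ℂ, LinearMap.mul' ℂ ℂ ∘ₗ TensorProduct.map ξ ζ ∘ₗ
      ((TensorProduct.map d LinearMap.id + TensorProduct.map parity d) ∘ₗ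
      (Coalgebra.comul : SW →ₗ[ℂ] SW ⊗[ℂ] SW)) =
      conv (ξ ∘ₗ d) ζ + conv (ξ ∘ₗ parity) (ζ ∘ₗ d) := by
    intro ξ ζ
    rw [LinearMap.add_comp, LinearMap.comp_add, LinearMap.comp_add, conv_comp_map, conv_comp_map,
      LinearMap.comp_id]
  constructor
  · intro h ξ ζ
    rw [← key, ← h]
    rfl
  · intro h
    refine ext_tensor fun ξ ζ => ?_
    rw [key, ← h]
    rfl

theorem conv_comp_lin (g : SW ≃ₗc[ℂ] SW) (ξ ζ : SW →ₗ[ℂ] ℂ) :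
    conv ξ ζ ∘ₗ lin g = conv (ξ ∘ₗ lin g) (ζ ∘ₗ lin g) := by
  rw [← conv_comp_map]
  have : TensorProduct.map (lin g) (lin g) ∘ₗ Coalgebra.comul = Coalgebra.comul ∘ₗ lin g :=
    g.map_comp_comul
  rw [this]
  rfl

theorem counit_comp_lin (g : SW ≃ₗc[ℂ] SW) : counitSW ∘ₗ lin g = counitSW :=
  g.counit_comp

theorem comul_comp_of_conv {f : SW →ₗ[ℂ] SW}
    (h : ∀ ξ ζ : SW →ₗ[ℂ] ℂ, conv ξ ζ ∘ₗ f = conv (ξ ∘ₗ f) (ζ ∘ₗ f)) :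
    TensorProduct.map f f ∘ₗ Coalgebra.comul = Coalgebra.comul ∘ₗ f := by
  refine ext_tensor fun ξ ζ => ?_
  rw [conv_comp_map, ← h]
  rfl

/-! ### Coordinate functionals -/

theorem taylor_counit : taylor counitSW = ⟨1, 0, 0, 0⟩ := by
  ext n <;> simp [taylor, coeff_series, counitSW_mono, coeff_one, Prod.ext_iff]
  split_ifs with h <;> simp [h]

theorem taylor_zero : taylor 0 = ⟨0, 0, 0, 0⟩ := by
  ext <;> simp [taylor, coeff_series]

theorem coord_zero : mono.coord 0 = counitSW := by
  refine mono.ext fun m => ?_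
  simp [counitSW_mono, Finsupp.single_apply]

theorem taylor_coord (n : ℕ) (j k : Fin 2) : taylor (mono.coord (n, j, k)) =
    ⟨if j = 0 ∧ k = 0 then C (n.factorial : ℂ)⁻¹ * X ^ n else 0,
      if j = 1 ∧ k = 0 then C (n.factorial : ℂ)⁻¹ * X ^ n else 0,
      if j = 0 ∧ k = 1 then C (n.factorial : ℂ)⁻¹ * X ^ n else 0,
      if j = 1 ∧ k = 1 then C (n.factorial : ℂ)⁻¹ * X ^ n else 0⟩ := by
  ext i <;> fin_cases j <;> fin_cases k <;>
    simp [taylor, coeff_series, Finsupp.single_apply, coeff_X_pow, eq_comm]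
  all_goals
    split_ifs with h
    · simp [h]
    · simp

theorem taylor_coord_one : taylor (mono.coord m₁) = ⟨X, 0, 0, 0⟩ := by
  simp [m₁, taylor_coord]

theorem taylor_coord_two : taylor (mono.coord m₂) = ⟨0, 1, 0, 0⟩ := by
  simp [m₂, taylor_coord]

theorem taylor_coord_three : taylor (mono.coord m₃) = ⟨0, 0, 1, 0⟩ := by
  simp [m₃, taylor_coord]

theorem coord_succ (n : ℕ) : mono.coord (n + 1, 0, 0) =
    ((n : ℂ) + 1)⁻¹ • conv (mono.coord (n, 0, 0)) (mono.coord m₁) := by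
  apply taylor_injective
  have e : ∀ (t : ℂ) (ξ : SW →ₗ[ℂ] ℂ), taylor (t • ξ) = ⟨C t * (taylor ξ).c, C t * (taylor ξ).y,
      C t * (taylor ξ).z, C t * (taylor ξ).w⟩ := by
    intro t ξ
    simp only [taylor, series_smul]
  rw [e, taylor_conv, taylor_coord_one, taylor_coord, taylor_coord]
  ext1 <;> simp [SuperFun.mul, Nat.factorial_succ, pow_succ]
  ring

theorem coord_two (n : ℕ) : mono.coord (n, 1, 0) =
    conv (mono.coord (n, 0, 0)) (mono.coord m₂) := by
  apply taylor_injective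
  rw [taylor_conv, taylor_coord_two, taylor_coord, taylor_coord]
  ext1 <;> simp [SuperFun.mul]

theorem coord_three (n : ℕ) (j : Fin 2) : mono.coord (n, j, 1) =
    conv (mono.coord (n, j, 0)) (mono.coord m₃) := by
  apply taylor_injective
  rw [taylor_conv, taylor_coord_three, taylor_coord, taylor_coord]
  fin_cases j <;> ext1 <;> simp [SuperFun.mul]

/-- The coordinate functionals are, up to scalars, products of the coordinates `x, θ₂, θ₃`. So
a property of functionals, depending on a weight and a degree, holds for all of them once it holds
for the generators and passes to products. -/
theorem coord_induction {P : ℕ → ℤ → (SW →ₗ[ℂ] ℂ) → Prop} (h0 : P 0 0 counitSW)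
    (h1 : P 1 0 (mono.coord m₁)) (h2 : P 1 (-1) (mono.coord m₂)) (h3 : P 1 1 (mono.coord m₃))
    (hs : ∀ (n : ℕ) (i : ℤ) (t : ℂ) ξ, P n i ξ → P n i (t • ξ))
    (hc : ∀ n n' i i' ξ ζ, P n i ξ → P n' i' ζ → P (n + n') (i + i') (conv ξ ζ)) (m : Mon) :
    P m.weight m.deg (mono.coord m) := by
  have H0 : ∀ n : ℕ, P n 0 (mono.coord (n, 0, 0)) := by
    intro n
    induction n with
    | zero =>
      have := coord_zero
      rw [show (0 : Mon) = (0, 0, 0) from rfl] at this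
      rwa [this]
    | succ n ih =>
      rw [coord_succ]
      exact hs _ _ _ _ (by simpa using hc _ _ _ _ _ _ ih h1)
  have H1 : ∀ (n : ℕ) (j : Fin 2), P (n + j.val) (-(j.val : ℤ)) (mono.coord (n, j, 0)) := by
    intro n j
    fin_cases j
    · simpa using H0 n
    · simpa [coord_two] using hc _ _ _ _ _ _ (H0 n) h2
  obtain ⟨n, j, k⟩ := m
  fin_cases k
  · simpa [Mon.weight, Mon.deg] using H1 n j
  · have := hc _ _ _ _ _ _ (H1 n j) h3
    simp only [Mon.weight, Mon.deg]
    change P (n + j.val + 1) (1 - j.val) (mono.coord (n, j, 1))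
    rw [coord_three]
    convert this using 1
    ring

/-! ### Odd vector fields -/

/-- The odd vector field `(a θ₂ + b θ₃) ∂/∂x + (p + q θ₂ θ₃) ∂/∂θ₂ + (r + s θ₂ θ₃) ∂/∂θ₃`. -/
structure OddField where
  a : ℂ⟦X⟧
  b : ℂ⟦X⟧
  p : ℂ⟦X⟧
  q : ℂ⟦X⟧
  r : ℂ⟦X⟧
  s : ℂ⟦X⟧

/-- The derivation of superfunctions given by an odd vector field. -/
def OddField.act (v : OddField) (u : SuperFun) : SuperFun :=
  ⟨u.y * v.p + u.z * v.r, derivative ℂ u.c * v.a - u.w * v.r,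
    derivative ℂ u.c * v.b + u.w * v.p,
    -derivative ℂ u.y * v.b + u.y * v.q + derivative ℂ u.z * v.a + u.z * v.s⟩

theorem OddField.act_mul (v : OddField) (u u' : SuperFun) : v.act (u.mul u') =
    ⟨((v.act u).mul u').c + (u.par.mul (v.act u')).c,
      ((v.act u).mul u').y + (u.par.mul (v.act u')).y,
      ((v.act u).mul u').z + (u.par.mul (v.act u')).z,
      ((v.act u).mul u').w + (u.par.mul (v.act u')).w⟩ := by
  ext1 <;> simp only [OddField.act, SuperFun.mul, SuperFun.par, Derivation.leibniz, map_add,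
    smul_eq_mul] <;> ring

/-- The transpose of the linear map `d` is the derivation given by the vector field `v`. -/
def Represents (v : OddField) (d : SW →ₗ[ℂ] SW) : Prop :=
  ∀ ξ : SW →ₗ[ℂ] ℂ, taylor (ξ ∘ₗ d) = v.act (taylor ξ)

theorem taylor_add (ξ ζ : SW →ₗ[ℂ] ℂ) : taylor (ξ + ζ) =
    ⟨(taylor ξ).c + (taylor ζ).c, (taylor ξ).y + (taylor ζ).y, (taylor ξ).z + (taylor ζ).z,
      (taylor ξ).w + (taylor ζ).w⟩ := by
  simp only [taylor, series_add]

theorem taylor_smul (t : ℂ) (ξ : SW →ₗ[ℂ] ℂ) : taylor (t • ξ) =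
    ⟨C t * (taylor ξ).c, C t * (taylor ξ).y, C t * (taylor ξ).z, C t * (taylor ξ).w⟩ := by
  simp only [taylor, series_smul]

theorem Represents.isOddCoderivation {v : OddField} {d : SW →ₗ[ℂ] SW} (h : Represents v d) :
    IsOddCoderivation d := by
  rw [isOddCoderivation_iff]
  intro ξ ζ
  apply taylor_injective
  rw [h, taylor_conv, taylor_add, taylor_conv, taylor_conv, h, h, taylor_comp_parity,
    OddField.act_mul]

/-- The vector field whose components are the corestrictions `S(W) → W` of the odd map `d`. -/
def fieldOf (d : SW →ₗ[ℂ] SW) : OddField where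
  a := series (mono.coord m₁ ∘ₗ d) 1 0
  b := series (mono.coord m₁ ∘ₗ d) 0 1
  p := series (mono.coord m₂ ∘ₗ d) 0 0
  q := series (mono.coord m₂ ∘ₗ d) 1 1
  r := series (mono.coord m₃ ∘ₗ d) 0 0
  s := series (mono.coord m₃ ∘ₗ d) 1 1

theorem coeff_series_coord_comp (d : SW →ₗ[ℂ] SW) (m : Mon) (j k : Fin 2) (n : ℕ) :
    coeff n (series (mono.coord m ∘ₗ d) j k) = entry d m (n, j, k) / (n.factorial : ℂ) := by
  rw [coeff_series]
  rfl

theorem series_coord_comp_eq_zero {A : Type} [Ring A] {d : SW →ₗ[ℂ] SW} {a : A}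
    (hd : HasDegree A d a) {m : Mon} {j k : Fin 2}
    (h : ((m.deg : ℤ) : A) ≠ (((k.val : ℤ) - (j.val : ℤ) : ℤ) : A) + a) :
    series (mono.coord m ∘ₗ d) j k = 0 := by
  ext n
  rw [coeff_series_coord_comp]
  by_cases h0 : entry d m (n, j, k) = 0
  · simp [h0]
  · exact absurd (hd _ _ h0) h

theorem counit_comp_coderivation {d : SW →ₗ[ℂ] SW} (hd : IsOddCoderivation d) :
    counitSW ∘ₗ d = 0 := by
  rw [isOddCoderivation_iff] at hd
  have h1 := congrArg taylor (hd counitSW counitSW)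
  have h2 : conv counitSW counitSW = counitSW := by
    apply taylor_injective
    rw [taylor_conv, taylor_counit]
    simp [SuperFun.mul]
  rw [h2, taylor_add, taylor_conv, taylor_conv, taylor_comp_parity, taylor_counit] at h1
  apply taylor_injective
  rw [SuperFun.ext_iff] at h1
  rw [taylor_zero]
  simp only [SuperFun.mul, SuperFun.par] at h1
  ext1 <;> simp at h1 ⊢ <;> grind

theorem coeff_mul_congr {u u' : ℂ⟦X⟧} {n : ℕ} (h : ∀ i ≤ n, coeff i u = coeff i u') (p : ℂ⟦X⟧) :
    coeff n (u * p) = coeff n (u' * p) := by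
  rw [coeff_mul, coeff_mul]
  refine Finset.sum_congr rfl fun a ha => ?_
  rw [h a.1 (by have := Finset.HasAntidiagonal.mem_antidiagonal.mp ha; omega)]

/-- The Taylor coefficients of order `n` of `v.act u` only depend on those of `u` up to order
`n + 1`. -/
theorem OddField.coeff_act_congr (v : OddField) {u u' : SuperFun} {n : ℕ}
    (h : ∀ i ≤ n + 1, coeff i u.c = coeff i u'.c ∧ coeff i u.y = coeff i u'.y ∧
      coeff i u.z = coeff i u'.z ∧ coeff i u.w = coeff i u'.w) :
    coeff n (v.act u).c = coeff n (v.act u').c ∧ coeff n (v.act u).y = coeff n (v.act u').y ∧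
      coeff n (v.act u).z = coeff n (v.act u').z ∧ coeff n (v.act u).w = coeff n (v.act u').w := by
  have hc : ∀ p, coeff n (derivative ℂ u.c * p) = coeff n (derivative ℂ u'.c * p) :=
    coeff_mul_congr fun i hi => by
      rw [coeff_derivative, coeff_derivative, (h (i + 1) (by omega)).1]
  have hy' : ∀ p, coeff n (derivative ℂ u.y * p) = coeff n (derivative ℂ u'.y * p) :=
    coeff_mul_congr fun i hi => by
      rw [coeff_derivative, coeff_derivative, (h (i + 1) (by omega)).2.1]
  have hz' : ∀ p, coeff n (derivative ℂ u.z * p) = coeff n (derivative ℂ u'.z * p) :=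
    coeff_mul_congr fun i hi => by
      rw [coeff_derivative, coeff_derivative, (h (i + 1) (by omega)).2.2.1]
  have hy : ∀ p, coeff n (u.y * p) = coeff n (u'.y * p) :=
    coeff_mul_congr fun i hi => (h i (by omega)).2.1
  have hz : ∀ p, coeff n (u.z * p) = coeff n (u'.z * p) :=
    coeff_mul_congr fun i hi => (h i (by omega)).2.2.1
  have hw : ∀ p, coeff n (u.w * p) = coeff n (u'.w * p) :=
    coeff_mul_congr fun i hi => (h i (by omega)).2.2.2
  simp only [OddField.act, map_add, map_sub, neg_mul, map_neg, hc, hy, hz, hw, hy', hz', and_self]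

/-- The functional that agrees with `ξ` on the monomials in `F` and kills the other ones. -/
def truncation (F : Finset Mon) (ξ : SW →ₗ[ℂ] ℂ) : SW →ₗ[ℂ] ℂ :=
  ∑ m ∈ F, ξ (mono m) • mono.coord m

theorem truncation_mono {F : Finset Mon} (ξ : SW →ₗ[ℂ] ℂ) {m : Mon} (hm : m ∈ F) :
    truncation F ξ (mono m) = ξ (mono m) := by
  classical
  simp [truncation, Finsupp.single_apply, hm]

theorem truncation_apply {F : Finset Mon} (ξ : SW →ₗ[ℂ] ℂ) {x : SW}
    (hx : (mono.repr x).support ⊆ F) : truncation F ξ x = ξ x := by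
  rw [← mono.linearCombination_repr x, Finsupp.linearCombination_apply, Finsupp.sum, map_sum,
    map_sum]
  refine Finset.sum_congr rfl fun m hm => ?_
  rw [map_smul, map_smul, truncation_mono ξ (hx hm)]

/-- A `ℤ₂`-odd coderivation is the vector field with the components given by its corestrictions. -/
theorem represents_fieldOf {d : SW →ₗ[ℂ] SW} (hd : IsOddCoderivation d)
    (hdeg : HasDegree (ZMod 2) d 1) : Represents (fieldOf d) d := by
  have hL := (isOddCoderivation_iff d).mp hd
  have hcoord : ∀ m, taylor (mono.coord m ∘ₗ d) = (fieldOf d).act (taylor (mono.coord m)) := by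
    intro m
    refine coord_induction
      (P := fun _ _ ξ => taylor (ξ ∘ₗ d) = (fieldOf d).act (taylor ξ)) ?_ ?_ ?_ ?_ ?_ ?_ m
    · rw [counit_comp_coderivation hd, taylor_counit]
      simp [taylor_zero, OddField.act]
    · rw [taylor_coord_one]
      ext1 <;> simp [OddField.act, taylor, fieldOf] <;>
        exact series_coord_comp_eq_zero hdeg (by decide)
    · rw [taylor_coord_two]
      ext1 <;> simp [OddField.act, taylor, fieldOf] <;>
        exact series_coord_comp_eq_zero hdeg (by decide)
    · rw [taylor_coord_three]
      ext1 <;> simp [OddField.act, taylor, fieldOf] <;>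
        exact series_coord_comp_eq_zero hdeg (by decide)
    · intro _ _ t ξ h
      rw [LinearMap.smul_comp, taylor_smul, taylor_smul, h]
      ext1 <;> simp [OddField.act] <;> ring
    · intro _ _ _ _ ξ ζ h h'
      rw [hL, taylor_add, taylor_conv, taylor_conv, taylor_conv, taylor_comp_parity, h, h',
        OddField.act_mul]
  have hfin : ∀ (F : Finset Mon) ξ,
      taylor (truncation F ξ ∘ₗ d) = (fieldOf d).act (taylor (truncation F ξ)) := by
    classical
    intro F ξ
    induction F using Finset.induction_on with
    | empty => simp [truncation, taylor_zero, OddField.act]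
    | insert m F hm ih =>
      have e : truncation (insert m F) ξ = ξ (mono m) • mono.coord m + truncation F ξ := by
        simp [truncation, hm]
      rw [e, LinearMap.add_comp, LinearMap.smul_comp, taylor_add, taylor_smul, taylor_add,
        taylor_smul, ih, hcoord]
      ext1 <;> simp [OddField.act] <;> ring
  -- For a general functional, both sides at order `n` only see finitely many of its values.
  classical
  intro ξ
  have main : ∀ n : ℕ, ∃ F : Finset Mon, (∀ j k, truncation F ξ (d (mono (n, j, k))) =
      ξ (d (mono (n, j, k)))) ∧ ∀ i ≤ n + 1, ∀ j k,
      coeff i (series (truncation F ξ) j k) = coeff i (series ξ j k) := by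
    intro n
    refine ⟨(Finset.univ.biUnion fun jk : Fin 2 × Fin 2 => (mono.repr (d (mono (n, jk)))).support) ∪
      Finset.range (n + 2) ×ˢ Finset.univ, fun j k => truncation_apply ξ ?_, fun i hi j k => ?_⟩
    · exact (Finset.subset_biUnion_of_mem (fun jk : Fin 2 × Fin 2 =>
        (mono.repr (d (mono (n, jk)))).support) (Finset.mem_univ (j, k))).trans
          Finset.subset_union_left
    · rw [coeff_series, coeff_series, truncation_mono]
      refine Finset.mem_union_right _ ?_
      simp only [Finset.mem_product, Finset.mem_range, Finset.mem_univ, and_true]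
      omega
  have h2 : ∀ n j k F, truncation F ξ (d (mono (n, j, k))) = ξ (d (mono (n, j, k))) →
      coeff n (series (ξ ∘ₗ d) j k) = coeff n (series (truncation F ξ ∘ₗ d) j k) := by
    intro n j k F h
    rw [coeff_series, coeff_series, LinearMap.comp_apply, LinearMap.comp_apply, h]
  have h3 : ∀ n, coeff n (taylor (ξ ∘ₗ d)).c = coeff n ((fieldOf d).act (taylor ξ)).c ∧
      coeff n (taylor (ξ ∘ₗ d)).y = coeff n ((fieldOf d).act (taylor ξ)).y ∧
      coeff n (taylor (ξ ∘ₗ d)).z = coeff n ((fieldOf d).act (taylor ξ)).z ∧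
      coeff n (taylor (ξ ∘ₗ d)).w = coeff n ((fieldOf d).act (taylor ξ)).w := by
    intro n
    obtain ⟨F, hF, hF'⟩ := main n
    have h4 := (fieldOf d).coeff_act_congr (u := taylor (truncation F ξ)) (u' := taylor ξ)
      fun i hi => ⟨hF' i hi 0 0, hF' i hi 1 0, hF' i hi 0 1, hF' i hi 1 1⟩
    rw [← hfin] at h4
    refine ⟨?_, ?_, ?_, ?_⟩
    · exact (h2 n 0 0 F (hF 0 0)).trans h4.1
    · exact (h2 n 1 0 F (hF 1 0)).trans h4.2.1
    · exact (h2 n 0 1 F (hF 0 1)).trans h4.2.2.1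
    · exact (h2 n 1 1 F (hF 1 1)).trans h4.2.2.2
  ext n
  exacts [(h3 n).1, (h3 n).2.1, (h3 n).2.2.1, (h3 n).2.2.2]

/-! ### Square-zero fields and their part of degree one -/

/-- The equations `d² x = 0`, `d² θ₂ = 0`, `d² θ₃ = 0`, spelled out. -/
theorem Represents.sq_zero_relations {v : OddField} {d : SW →ₗ[ℂ] SW} (h : Represents v d)
    (hd : d ∘ₗ d = 0) :
    v.a * v.p + v.b * v.r = 0 ∧
    v.a * v.q + v.b * v.s = derivative ℂ v.a * v.b - derivative ℂ v.b * v.a ∧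
    derivative ℂ v.p * v.a = v.q * v.r ∧ derivative ℂ v.r * v.a = v.s * v.r ∧
    derivative ℂ v.p * v.b = -(v.q * v.p) ∧ derivative ℂ v.r * v.b = -(v.s * v.p) := by
  have key : ∀ ξ : SW →ₗ[ℂ] ℂ, v.act (v.act (taylor ξ)) = ⟨0, 0, 0, 0⟩ := by
    intro ξ
    rw [← h, ← h, LinearMap.comp_assoc, hd, LinearMap.comp_zero, taylor_zero]
  have h1 := key (mono.coord m₁)
  have h2 := key (mono.coord m₂)
  have h3 := key (mono.coord m₃)
  rw [taylor_coord_one, SuperFun.ext_iff] at h1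
  rw [taylor_coord_two, SuperFun.ext_iff] at h2
  rw [taylor_coord_three, SuperFun.ext_iff] at h3
  simp [OddField.act] at h1 h2 h3
  refine ⟨h1.1, ?_, ?_, ?_, ?_, ?_⟩
  · linear_combination h1.2
  · linear_combination h2.1
  · linear_combination h3.1
  · linear_combination h2.2
  · linear_combination h3.2

/-- The component of `ℤ`-degree one of a linear map. -/
def degreeOnePart (d : SW →ₗ[ℂ] SW) : SW →ₗ[ℂ] SW :=
  mono.constr ℂ fun m => proj ℤ (m.deg + 1) (d (mono m))

theorem entry_degreeOnePart (d : SW →ₗ[ℂ] SW) (m' m : Mon) :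
    entry (degreeOnePart d) m' m = if m'.deg = m.deg + 1 then entry d m' m else 0 := by
  simp [entry, degreeOnePart, repr_proj]

theorem ext_entry {f g : SW →ₗ[ℂ] SW} (h : ∀ m m', entry f m' m = entry g m' m) : f = g :=
  mono.ext fun m => mono.ext_elem fun m' => h m m'

theorem hasDegree_degreeOnePart (d : SW →ₗ[ℂ] SW) : HasDegree ℤ (degreeOnePart d) 1 := by
  intro m m' h
  rw [entry_degreeOnePart] at h
  by_contra h'
  exact h (if_neg (by simpa using h'))

theorem degreeOnePart_eq_self {d : SW →ₗ[ℂ] SW} (hd : HasDegree ℤ d 1) : degreeOnePart d = d := by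
  refine ext_entry fun m m' => ?_
  rw [entry_degreeOnePart]
  split_ifs with h
  · rfl
  · by_contra h'
    exact h (by simpa using hd m m' (Ne.symm h'))

/-- The vector field of degree one that remains of `v` when `b`, `p` and `q` are dropped. -/
def OddField.degreeOne (v : OddField) : OddField := ⟨v.a, 0, 0, 0, v.r, v.s⟩

theorem Represents.degreeOnePart {v : OddField} {d : SW →ₗ[ℂ] SW} (h : Represents v d) :
    Represents v.degreeOne (degreeOnePart d) := by
  intro ξ
  have e : ∀ (m : Mon), ξ (LInfty.degreeOnePart d (mono m)) =
      (ξ ∘ₗ proj ℤ (m.deg + 1) ∘ₗ d) (mono m) := by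
    intro m
    simp [LInfty.degreeOnePart]
  have hs : ∀ j k : Fin 2, series (ξ ∘ₗ LInfty.degreeOnePart d) j k =
      series ((ξ ∘ₗ proj ℤ (((k.val : ℤ) - (j.val : ℤ)) + 1)) ∘ₗ d) j k := by
    intro j k
    ext n
    rw [coeff_series, coeff_series, LinearMap.comp_apply, e]
    rfl
  have hp : ∀ (i : ℤ) (j k : Fin 2), series (ξ ∘ₗ proj ℤ i) j k =
      if (k.val : ℤ) - (j.val : ℤ) = i then series ξ j k else 0 := by
    intro i j k
    classical
    ext n
    rw [coeff_series, LinearMap.comp_apply, proj_mono]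
    by_cases h : (k.val : ℤ) - (j.val : ℤ) = i <;> simp [Mon.deg, h, coeff_series]
  have key : ∀ i, taylor ((ξ ∘ₗ proj ℤ i) ∘ₗ d) = _ := fun i => h _
  simp only [taylor, hp, OddField.act, SuperFun.mk.injEq] at key
  simp only [taylor, hs, OddField.act, SuperFun.mk.injEq, OddField.degreeOne]
  refine ⟨?_, ?_, ?_, ?_⟩
  · rw [(key _).1]; simp
  · rw [(key _).2.1]; simp
  · rw [(key _).2.2.1]; simp
  · rw [(key _).2.2.2]; simp

theorem hasDegree_two_of_int {d : SW →ₗ[ℂ] SW} (hd : HasDegree ℤ d 1) :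
    HasDegree (ZMod 2) d 1 := by
  simpa using hd.cast (A := ZMod 2)

theorem fieldOf_eq_degreeOne {d : SW →ₗ[ℂ] SW} (hd : HasDegree ℤ d 1) :
    fieldOf d = (fieldOf d).degreeOne := by
  simp only [OddField.degreeOne, fieldOf, OddField.mk.injEq, true_and, and_true]
  refine ⟨?_, ?_, ?_⟩ <;> exact series_coord_comp_eq_zero hd (by decide)

/-- The part of `ℤ`-degree one of a `ℤ₂`-graded codifferential. Its square vanishes, since `d²` has
no component of degree two. -/
def Codiff.part (d : Codiff (ZMod 2)) : Codiff ℤ where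
  toMap := degreeOnePart d.toMap
  isCoder := (represents_fieldOf d.isCoder d.hasDegree).degreeOnePart.isOddCoderivation
  map_one := by simp [degreeOnePart, d.map_one]
  hasDegree := hasDegree_degreeOnePart _
  sq_zero := by
    have h := represents_fieldOf d.isCoder d.hasDegree
    have hr := (h.sq_zero_relations d.sq_zero).2.2.2.1
    have h' := h.degreeOnePart
    refine ext_taylor fun ξ => ?_
    rw [← LinearMap.comp_assoc, h', h', LinearMap.comp_zero, taylor_zero]
    ext1 <;> simp [OddField.act, OddField.degreeOne]
    linear_combination (taylor ξ).z * hr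

/-! ### Shears -/

/-- The linear map with transpose `θ₂ ↦ θ₂ + f θ₃`, `θ₃ ↦ θ₃ + κ θ₂`, `x ↦ x`, `θ₂ θ₃ ↦ θ₂ θ₃`. -/
def shearMap (κ f : ℂ⟦X⟧) : SW →ₗ[ℂ] SW :=
  mono.constr ℂ fun m => mono m +
    ((if m.2 = (1, 0) then ∑ a ∈ Finset.HasAntidiagonal.antidiagonal m.1,
        ((m.1.factorial : ℂ) * ((a.1.factorial : ℂ)⁻¹ * coeff a.2 κ)) • mono (a.1, 0, 1) else 0) +
      if m.2 = (0, 1) then ∑ a ∈ Finset.HasAntidiagonal.antidiagonal m.1,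
        ((m.1.factorial : ℂ) * ((a.1.factorial : ℂ)⁻¹ * coeff a.2 f)) • mono (a.1, 1, 0) else 0)

theorem taylor_comp_shearMap (κ f : ℂ⟦X⟧) (ξ : SW →ₗ[ℂ] ℂ) : taylor (ξ ∘ₗ shearMap κ f) =
    ⟨(taylor ξ).c, (taylor ξ).y + (taylor ξ).z * κ, (taylor ξ).z + (taylor ξ).y * f,
      (taylor ξ).w⟩ := by
  have h : ∀ n : ℕ, (n.factorial : ℂ) ≠ 0 := fun n => by exact_mod_cast n.factorial_ne_zero
  ext n
  · simp [taylor, coeff_series, shearMap]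
  · simp only [taylor, coeff_series, shearMap, map_add, LinearMap.comp_apply,
      Module.Basis.constr_basis, coeff_mul, Prod.mk.injEq]
    simp [add_div, Finset.sum_div]
    refine Finset.sum_congr rfl fun a ha => ?_
    field_simp [h]
  · simp only [taylor, coeff_series, shearMap, map_add, LinearMap.comp_apply,
      Module.Basis.constr_basis, coeff_mul, Prod.mk.injEq]
    simp [add_div, Finset.sum_div]
    refine Finset.sum_congr rfl fun a ha => ?_
    field_simp [h]
  · simp [taylor, coeff_series, shearMap]

theorem shearMap_comp_neg {κ f : ℂ⟦X⟧} (h : κ * f = 0) :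
    shearMap κ f ∘ₗ shearMap (-κ) (-f) = LinearMap.id := by
  refine ext_taylor fun ξ => ?_
  rw [← LinearMap.comp_assoc, taylor_comp_shearMap, taylor_comp_shearMap, LinearMap.comp_id]
  ext1 <;> simp only
  · linear_combination (-(taylor ξ).y) * h
  · linear_combination (-(taylor ξ).z) * h

/-- The coalgebra automorphism of `S(W)` with transpose `θ₂ ↦ θ₂ + f θ₃`, `θ₃ ↦ θ₃ + κ θ₂`,
`x ↦ x`, where one of `κ` and `f` is zero. -/
def shear (κ f : ℂ⟦X⟧) (h : κ * f = 0) : SW ≃ₗc[ℂ] SW where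
  __ : SW ≃ₗ[ℂ] SW := LinearEquiv.ofLinearMap (shearMap κ f) (shearMap (-κ) (-f))
    (shearMap_comp_neg h)
    (by simpa using shearMap_comp_neg (κ := -κ) (f := -f) (by simpa using h))
  counit_comp := by
    change counitSW ∘ₗ shearMap κ f = counitSW
    apply taylor_injective
    rw [taylor_comp_shearMap, taylor_counit]
    simp
  map_comp_comul := by
    refine comul_comp_of_conv (f := shearMap κ f) fun ξ ζ => ?_
    apply taylor_injective
    rw [taylor_comp_shearMap, taylor_conv, taylor_conv, taylor_comp_shearMap, taylor_comp_shearMap]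
    ext1 <;> simp only [SuperFun.mul]
    · ring
    · ring
    · linear_combination (((taylor ξ).y * (taylor ζ).z - (taylor ξ).z * (taylor ζ).y)) * h

theorem lin_shear (κ f : ℂ⟦X⟧) (h : κ * f = 0) : lin (shear κ f h) = shearMap κ f := rfl

theorem lin_shear_symm (κ f : ℂ⟦X⟧) (h : κ * f = 0) :
    lin (shear κ f h).symm = shearMap (-κ) (-f) := rfl

/-- The shears `θ₃ ↦ θ₃ + κ θ₂` commute with the odd vector fields of degree one, as `θ₂ θ₂ = 0`
and `d θ₂ = 0`. -/
theorem Represents.shearMap_comm {v : OddField} {d : SW →ₗ[ℂ] SW}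
    (h : Represents v.degreeOne d) (κ : ℂ⟦X⟧) : d ∘ₗ shearMap κ 0 = shearMap κ 0 ∘ₗ d := by
  refine ext_taylor fun ξ => ?_
  rw [← LinearMap.comp_assoc, ← LinearMap.comp_assoc, taylor_comp_shearMap, h, h,
    taylor_comp_shearMap]
  ext1 <;> simp [OddField.act, OddField.degreeOne]

/-- If `(p, q, b)` is obtained from `(r, s, a)` by means of `f`, the shear `θ₂ ↦ θ₂ + f θ₃` removes
everything from the vector field but its part of degree one. -/
theorem Represents.comp_shearMap {v : OddField} {d : SW →ₗ[ℂ] SW} (h : Represents v d)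
    {f : ℂ⟦X⟧} (hp : v.p = f * v.r) (hb : v.b = -(f * v.a))
    (hq : v.q = f * v.s + derivative ℂ f * v.a) :
    d ∘ₗ shearMap 0 f = shearMap 0 f ∘ₗ LInfty.degreeOnePart d := by
  refine ext_taylor fun ξ => ?_
  rw [← LinearMap.comp_assoc, ← LinearMap.comp_assoc, taylor_comp_shearMap, h, h.degreeOnePart,
    taylor_comp_shearMap]
  ext1 <;> simp [OddField.act, OddField.degreeOne, hp, hb, hq] <;> ring

/-! ### Homogeneous functionals -/

/-- The functional `ξ` vanishes on all monomials whose degree is not `a`. -/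
def IsHomog (A : Type) [Ring A] (a : A) (ξ : SW →ₗ[ℂ] ℂ) : Prop :=
  ∀ m : Mon, ξ (mono m) ≠ 0 → ((m.deg : ℤ) : A) = a

theorem isHomog_of_taylor {A : Type} [Ring A] {a : A} {ξ : SW →ₗ[ℂ] ℂ}
    (h0 : a ≠ 0 → (taylor ξ).c = 0 ∧ (taylor ξ).w = 0) (h1 : a ≠ -1 → (taylor ξ).y = 0)
    (h2 : a ≠ 1 → (taylor ξ).z = 0) : IsHomog A a ξ := by
  rintro ⟨n, j, k⟩ hm
  rw [apply_mono_eq] at hm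
  by_contra hne
  apply hm
  fin_cases j <;> fin_cases k <;> simp [Mon.deg] at hne ⊢ <;> right
  · have := (h0 (Ne.symm hne)).1
    simp only [taylor] at this
    simp [this]
  · have := h2 (Ne.symm hne)
    simp only [taylor] at this
    simp [this]
  · have := h1 (Ne.symm hne)
    simp only [taylor] at this
    simp [this]
  · have := (h0 (Ne.symm hne)).2
    simp only [taylor] at this
    simp [this]

theorem exists_of_conv_ne_zero {ξ ζ : SW →ₗ[ℂ] ℂ} {m : Mon} (h : conv ξ ζ (mono m) ≠ 0) :
    ∃ m' m'' : Mon, m.weight = m'.weight + m''.weight ∧ m.deg = m'.deg + m''.deg ∧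
      ξ (mono m') ≠ 0 ∧ ζ (mono m'') ≠ 0 := by
  rw [conv_mono] at h
  obtain ⟨a, ha, h⟩ := Finset.exists_ne_zero_of_sum_ne_zero h
  obtain ⟨b, hb, h⟩ := Finset.exists_ne_zero_of_sum_ne_zero h
  obtain ⟨c, hc, h⟩ := Finset.exists_ne_zero_of_sum_ne_zero h
  simp only [Finset.HasAntidiagonal.mem_antidiagonal, splits, Finset.mem_filter, Finset.mem_univ,
    true_and] at ha hb hc
  refine ⟨(a.1, b.1, c.1), (a.2, b.2, c.2), ?_, ?_, ?_, ?_⟩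
  · simp only [Mon.weight]; omega
  · simp only [Mon.deg]; omega
  · exact left_ne_zero_of_mul (right_ne_zero_of_mul h)
  · exact right_ne_zero_of_mul (right_ne_zero_of_mul h)

/-- An automorphism of `S(W)` has degree zero if it preserves the degrees of `x`, `θ₂`, `θ₃`. -/
theorem hasDegree_zero_of_coord {A : Type} [Ring A] {g : SW ≃ₗc[ℂ] SW}
    (h1 : IsHomog A 0 (mono.coord m₁ ∘ₗ lin g)) (h2 : IsHomog A (-1) (mono.coord m₂ ∘ₗ lin g))
    (h3 : IsHomog A 1 (mono.coord m₃ ∘ₗ lin g)) : HasDegree A (lin g) 0 := by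
  intro m m' hne
  have := coord_induction (P := fun _ i ξ => IsHomog A (i : A) (ξ ∘ₗ lin g)) ?_ (by simpa using h1)
    (by simpa using h2) (by simpa using h3) ?_ ?_ m'
  · rw [add_zero]
    exact (this m hne).symm
  · rw [counit_comp_lin]
    intro n hn
    rw [counitSW_mono] at hn
    have : n = 0 := by
      by_contra h
      exact hn (if_neg h)
    simp [this, Mon.deg]
  · intro _ i t ξ h n hn
    refine h n ?_
    rw [LinearMap.smul_comp, LinearMap.smul_apply] at hn
    exact right_ne_zero_of_smul hn
  · intro _ _ i i' ξ ζ h h' n hn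
    rw [conv_comp_lin] at hn
    obtain ⟨n', n'', -, hd, hn', hn''⟩ := exists_of_conv_ne_zero hn
    rw [hd, Int.cast_add, h _ hn', h' _ hn'', Int.cast_add]

theorem hasDegree_shear (κ f : ℂ⟦X⟧) (h : κ * f = 0) :
    HasDegree (ZMod 2) (lin (shear κ f h)) 0 := by
  refine hasDegree_zero_of_coord ?_ ?_ ?_ <;>
  · rw [lin_shear]
    refine isHomog_of_taylor ?_ ?_ ?_ <;>
    · rw [taylor_comp_shearMap]
      simp [taylor_coord_one, taylor_coord_two, taylor_coord_three]
      try decide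

/-! ### Automorphisms and the filtration by weight -/

/-- The functional `ξ` vanishes on the monomials of weight less than `n`. -/
def VanishesBelow (n : ℕ) (ξ : SW →ₗ[ℂ] ℂ) : Prop := ∀ m : Mon, ξ (mono m) ≠ 0 → n ≤ m.weight

theorem VanishesBelow.conv {n n' : ℕ} {ξ ζ : SW →ₗ[ℂ] ℂ} (h : VanishesBelow n ξ)
    (h' : VanishesBelow n' ζ) : VanishesBelow (n + n') (conv ξ ζ) := by
  intro m hm
  obtain ⟨m', m'', hw, -, h1, h2⟩ := exists_of_conv_ne_zero hm
  rw [hw]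
  exact add_le_add (h _ h1) (h' _ h2)

theorem VanishesBelow.add {n : ℕ} {ξ ζ : SW →ₗ[ℂ] ℂ} (h : VanishesBelow n ξ)
    (h' : VanishesBelow n ζ) : VanishesBelow n (ξ + ζ) := by
  intro m hm
  by_contra hn
  apply hm
  rw [LinearMap.add_apply, not_not.mp fun h1 => hn (h m h1), not_not.mp fun h1 => hn (h' m h1),
    add_zero]

theorem VanishesBelow.smul {n : ℕ} {ξ : SW →ₗ[ℂ] ℂ} (h : VanishesBelow n ξ) (t : ℂ) :
    VanishesBelow n (t • ξ) := fun m hm =>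
  h m (right_ne_zero_of_smul (a := t) hm)

theorem VanishesBelow.comp_parity {n : ℕ} {ξ : SW →ₗ[ℂ] ℂ} (h : VanishesBelow n ξ) :
    VanishesBelow n (ξ ∘ₗ parity) := by
  intro m hm
  refine h m fun h0 => hm ?_
  simp [parity, h0]

theorem Mon.weight_eq_zero {m : Mon} (h : m.weight = 0) : m = 0 := by
  obtain ⟨n, j, k⟩ := m
  simp only [Mon.weight] at h
  have h1 : n = 0 := by omega
  have h2 : j = 0 := by ext; simp; omega
  have h3 : k = 0 := by ext; simp; omega
  subst h1 h2 h3
  rfl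

theorem Mon.weight_eq_one {m : Mon} (h : m.weight = 1) : m = m₁ ∨ m = m₂ ∨ m = m₃ := by
  obtain ⟨n, j, k⟩ := m
  fin_cases j <;> fin_cases k <;> simp_all [Mon.weight, m₁, m₂, m₃]

theorem vanishesBelow_one {ξ : SW →ₗ[ℂ] ℂ} (h : ξ (mono 0) = 0) : VanishesBelow 1 ξ := by
  intro m hm
  by_contra hw
  rw [Mon.weight_eq_zero (m := m) (by omega)] at hm
  exact hm h

theorem vanishesBelow_zero (ξ : SW →ₗ[ℂ] ℂ) : VanishesBelow 0 ξ := fun _ _ => Nat.zero_le _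

theorem conv_one (ξ ζ : SW →ₗ[ℂ] ℂ) : conv ξ ζ (mono 0) = ξ (mono 0) * ζ (mono 0) := by
  have : (0 : Mon) = (0, 0, 0) := rfl
  rw [conv_mono, this]
  simp [splits_zero]

/-- The element `1` is the only group-like element of `S(W)`, so all automorphisms fix it. A
group-like element `u` is `∑ tⁿ e₁ⁿ / n!` for some `t`, and this sum has to be finite. -/
theorem lin_one (g : SW ≃ₗc[ℂ] SW) : lin g (mono 0) = mono 0 := by
  set u := lin g (mono 0) with hu
  have hmul : ∀ ξ ζ : SW →ₗ[ℂ] ℂ, conv ξ ζ u = ξ u * ζ u := by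
    intro ξ ζ
    have := LinearMap.congr_fun (conv_comp_lin g ξ ζ) (mono 0)
    rwa [conv_one] at this
  have hcounit : counitSW u = 1 := by
    have := LinearMap.congr_fun (counit_comp_lin g) (mono 0)
    simpa [counitSW_mono] using this
  have hconv_self : ∀ m : Mon, m = m₂ ∨ m = m₃ → mono.coord m u = 0 := by
    intro m hm
    have h1 : conv (mono.coord m) (mono.coord m) = 0 := by
      apply taylor_injective
      rw [taylor_conv, taylor_zero]
      rcases hm with rfl | rfl
      · rw [taylor_coord_two]; simp [SuperFun.mul]
      · rw [taylor_coord_three]; simp [SuperFun.mul]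
    have h2 := hmul (mono.coord m) (mono.coord m)
    rw [h1] at h2
    exact mul_self_eq_zero.mp h2.symm
  have hx : mono.coord m₁ u = 0 := by
    by_contra hne
    have hall : ∀ n : ℕ, mono.coord (n, 0, 0) u ≠ 0 := by
      intro n
      induction n with
      | zero =>
        have := coord_zero
        rw [show (0 : Mon) = (0, 0, 0) from rfl] at this
        rw [this, hcounit]
        exact one_ne_zero
      | succ n ih =>
        rw [coord_succ, LinearMap.smul_apply, hmul]
        refine smul_ne_zero (inv_ne_zero ?_) (mul_ne_zero ih hne)
        exact_mod_cast n.succ_ne_zero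
    refine Set.infinite_of_injective_forall_mem (f := fun n : ℕ => ((n, 0, 0) : Mon)) ?_ ?_
      (mono.repr u).support.finite_toSet
    · intro a b h
      simpa using h
    · intro n
      simpa using hall n
  refine mono.ext_elem fun m => ?_
  by_cases hm : m = 0
  · subst hm
    have : mono.coord 0 u = 1 := by rw [coord_zero, hcounit]
    simpa using this
  · have := coord_induction (P := fun n _ ξ => 1 ≤ n → ξ u = 0) (by simp) (fun _ => hx)
      (fun _ => hconv_self _ (Or.inl rfl)) (fun _ => hconv_self _ (Or.inr rfl)) ?_ ?_ m ?_
    · rw [Module.Basis.coord_apply] at this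
      rw [this]
      simp [hm]
    · intro n i t ξ h hn
      rw [LinearMap.smul_apply, h hn, smul_zero]
    · intro n n' i i' ξ ζ h h' hn
      rw [hmul]
      by_cases h0 : 1 ≤ n
      · rw [h h0, zero_mul]
      · rw [h' (by omega), mul_zero]
    · by_contra h0
      exact hm (Mon.weight_eq_zero (by omega))

theorem coord_mono_zero {m : Mon} (hm : m ≠ 0) : mono.coord m (mono 0) = 0 := by
  simp [Ne.symm hm]

theorem m₁_ne_zero : m₁ ≠ 0 := by decide
theorem m₂_ne_zero : m₂ ≠ 0 := by decide
theorem m₃_ne_zero : m₃ ≠ 0 := by decide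

theorem weight_le_of_entry_lin {g : SW ≃ₗc[ℂ] SW} {m m' : Mon} (h : entry (lin g) m' m ≠ 0) :
    m'.weight ≤ m.weight := by
  have h1 : ∀ m : Mon, m ≠ 0 → VanishesBelow 1 (mono.coord m ∘ₗ lin g) := fun m hm =>
    vanishesBelow_one (by rw [LinearMap.comp_apply, lin_one, coord_mono_zero hm])
  refine coord_induction (P := fun n _ ξ => VanishesBelow n (ξ ∘ₗ lin g)) (vanishesBelow_zero _)
    (h1 _ m₁_ne_zero) (h1 _ m₂_ne_zero) (h1 _ m₃_ne_zero) ?_ ?_ m' m h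
  · intro n i t ξ h
    exact h.smul t
  · intro n n' i i' ξ ζ h h'
    rw [conv_comp_lin]
    exact h.conv h'

theorem weight_le_of_entry_coderivation {d : SW →ₗ[ℂ] SW} (hd : IsOddCoderivation d)
    (h0 : d (mono 0) = 0) {m m' : Mon} (h : entry d m' m ≠ 0) : m'.weight ≤ m.weight := by
  have h1 : ∀ m : Mon, m ≠ 0 →
      VanishesBelow 1 (mono.coord m) ∧ VanishesBelow 1 (mono.coord m ∘ₗ d) := fun m hm =>
    ⟨vanishesBelow_one (coord_mono_zero hm),
      vanishesBelow_one (by rw [LinearMap.comp_apply, h0, map_zero])⟩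
  refine (coord_induction (P := fun n _ ξ => VanishesBelow n ξ ∧ VanishesBelow n (ξ ∘ₗ d))
    ⟨vanishesBelow_zero _, vanishesBelow_zero _⟩ (h1 _ m₁_ne_zero) (h1 _ m₂_ne_zero)
    (h1 _ m₃_ne_zero) ?_ ?_ m').2 m h
  · intro n i t ξ h
    exact ⟨h.1.smul t, h.2.smul t⟩
  · intro n n' i i' ξ ζ h h'
    rw [(isOddCoderivation_iff d).mp hd]
    exact ⟨h.1.conv h'.1, (h.2.conv h'.1).add (h.1.comp_parity.conv h'.2)⟩

theorem entry_lin_zero (g : SW ≃ₗc[ℂ] SW) (m : Mon) :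
    entry (lin g) 0 m = if m = 0 then 1 else 0 := by
  have := LinearMap.congr_fun (counit_comp_lin g) (mono m)
  rw [counitSW_mono, ← coord_zero] at this
  exact this

/-- An automorphism of `S(W)` maps `W` to itself, and is injective there. -/
theorem exists_entry_lin_ne_zero (g : SW ≃ₗc[ℂ] SW) {m : Mon} (hm : m.weight = 1) :
    entry (lin g) m₁ m ≠ 0 ∨ entry (lin g) m₂ m ≠ 0 ∨ entry (lin g) m₃ m ≠ 0 := by
  by_contra! h
  have h0 : lin g (mono m) = 0 := by
    refine mono.ext_elem fun m' => ?_
    change entry (lin g) m' m = _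
    rw [map_zero, Finsupp.zero_apply]
    by_contra hne
    have hw := weight_le_of_entry_lin hne
    rw [hm] at hw
    rcases Nat.le_one_iff_eq_zero_or_eq_one.mp hw with hw | hw
    · rw [Mon.weight_eq_zero hw, entry_lin_zero] at hne
      apply hne
      rw [if_neg]
      rintro rfl
      simp [Mon.weight] at hm
    · rcases Mon.weight_eq_one hw with rfl | rfl | rfl
      exacts [hne h.1, hne h.2.1, hne h.2.2]
  have := lin_symm_lin g (mono m)
  rw [h0, map_zero] at this
  exact mono.ne_zero m this.symm

/-! ### The action of automorphisms on codifferentials -/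

theorem entry_comp (f h : SW →ₗ[ℂ] SW) (m' m : Mon) {F : Finset Mon}
    (hF : ∀ n, entry h n m ≠ 0 → n ∈ F) :
    entry (f ∘ₗ h) m' m = ∑ n ∈ F, entry h n m * entry f m' n := by
  have e : h (mono m) = ∑ n ∈ F, entry h n m • mono n := by
    conv_lhs => rw [← mono.linearCombination_repr (h (mono m))]
    rw [Finsupp.linearCombination_apply]
    refine Finsupp.sum_of_support_subset _ (fun n hn => hF n ?_) _ (by simp)
    exact Finsupp.mem_support_iff.mp hn
  rw [entry, LinearMap.comp_apply, e]
  simp [entry]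

theorem exists_entry_of_comp {f h : SW →ₗ[ℂ] SW} {m' m : Mon} (hne : entry (f ∘ₗ h) m' m ≠ 0) :
    ∃ n, entry h n m ≠ 0 ∧ entry f m' n ≠ 0 := by
  rw [entry_comp f h m' m (F := (mono.repr (h (mono m))).support)
    (fun n hn => Finsupp.mem_support_iff.mpr hn)] at hne
  obtain ⟨n, -, hn⟩ := Finset.exists_ne_zero_of_sum_ne_zero hne
  exact ⟨n, left_ne_zero_of_mul hn, right_ne_zero_of_mul hn⟩

theorem HasDegree.comp {A : Type} [Ring A] {f h : SW →ₗ[ℂ] SW} {a b : A} (hf : HasDegree A f a)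
    (hh : HasDegree A h b) : HasDegree A (f ∘ₗ h) (b + a) := by
  intro m m' hne
  obtain ⟨n, h1, h2⟩ := exists_entry_of_comp hne
  rw [hf _ _ h2, hh _ _ h1, add_assoc]

theorem HasDegree.pull {A : Type} [Ring A] {d : SW →ₗ[ℂ] SW} {a : A} (hd : HasDegree A d a)
    {g : SW ≃ₗc[ℂ] SW} (hg : HasDegree A (lin g) 0) : HasDegree A (pull g d) a := by
  have := (hasDegree_symm hg).comp (hd.comp hg)
  rwa [zero_add, add_zero] at this

theorem lin_symm_comp_lin (g : SW ≃ₗc[ℂ] SW) : lin g.symm ∘ₗ lin g = LinearMap.id :=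
  LinearMap.ext (lin_symm_lin g)

theorem lin_comp_lin_symm (g : SW ≃ₗc[ℂ] SW) : lin g ∘ₗ lin g.symm = LinearMap.id :=
  LinearMap.ext (lin_lin_symm g)

theorem lin_comp_pull (g : SW ≃ₗc[ℂ] SW) (d : SW →ₗ[ℂ] SW) :
    lin g ∘ₗ pull g d = d ∘ₗ lin g := by
  rw [pull, ← LinearMap.comp_assoc, lin_comp_lin_symm, LinearMap.id_comp]

theorem pull_eq_of_comp_eq {g : SW ≃ₗc[ℂ] SW} {d d' : SW →ₗ[ℂ] SW}
    (h : d ∘ₗ lin g = lin g ∘ₗ d') : pull g d = d' := by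
  rw [pull, h, ← LinearMap.comp_assoc, lin_symm_comp_lin, LinearMap.id_comp]

theorem lin_trans (g h : SW ≃ₗc[ℂ] SW) : lin (h.trans g) = lin g ∘ₗ lin h := rfl

theorem pull_trans (g h : SW ≃ₗc[ℂ] SW) (d : SW →ₗ[ℂ] SW) :
    pull (h.trans g) d = pull h (pull g d) := by
  ext x; rfl

theorem pull_symm_pull (g : SW ≃ₗc[ℂ] SW) (d : SW →ₗ[ℂ] SW) : pull g.symm (pull g d) = d :=
  pull_eq_of_comp_eq (by
    rw [pull, LinearMap.comp_assoc, LinearMap.comp_assoc, lin_comp_lin_symm, LinearMap.comp_id])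

theorem lin_comp_parity {g : SW ≃ₗc[ℂ] SW} (hg : HasDegree (ZMod 2) (lin g) 0) :
    lin g ∘ₗ parity = parity ∘ₗ lin g := by
  have h : parity = proj (ZMod 2) 0 - proj (ZMod 2) 1 := by
    classical
    refine mono.ext ?_
    rintro ⟨n, j, k⟩
    rw [LinearMap.sub_apply, proj_mono, proj_mono]
    fin_cases j <;> fin_cases k <;> simp [parity, Mon.deg]
  rw [hasDegree_zero_iff] at hg
  ext x
  simp [h, hg]

theorem IsOddCoderivation.pull {d : SW →ₗ[ℂ] SW} (hd : IsOddCoderivation d) {g : SW ≃ₗc[ℂ] SW}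
    (hg : HasDegree (ZMod 2) (lin g) 0) : IsOddCoderivation (pull g d) := by
  rw [isOddCoderivation_iff] at hd ⊢
  intro ξ ζ
  have hp : lin g.symm ∘ₗ parity ∘ₗ lin g = parity := by
    rw [← lin_comp_parity hg, ← LinearMap.comp_assoc, lin_symm_comp_lin, LinearMap.id_comp]
  have hid : ∀ χ : SW →ₗ[ℂ] ℂ, (χ ∘ₗ lin g.symm) ∘ₗ lin g = χ := by
    intro χ
    rw [LinearMap.comp_assoc, lin_symm_comp_lin, LinearMap.comp_id]
  calc conv ξ ζ ∘ₗ LInfty.pull g d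
      = ((conv ξ ζ ∘ₗ lin g.symm) ∘ₗ d) ∘ₗ lin g := rfl
    _ = conv (ξ ∘ₗ LInfty.pull g d) ((ζ ∘ₗ lin g.symm) ∘ₗ lin g) +
        conv (ξ ∘ₗ lin g.symm ∘ₗ parity ∘ₗ lin g) (ζ ∘ₗ LInfty.pull g d) := by
      rw [conv_comp_lin, hd, LinearMap.add_comp, conv_comp_lin, conv_comp_lin]
      rfl
    _ = _ := by rw [hp, hid]

/-- The codifferential `g^*(d)`, for an even automorphism `g`. -/
def Codiff.pull (d : Codiff (ZMod 2)) (g : SW ≃ₗc[ℂ] SW) (hg : HasDegree (ZMod 2) (lin g) 0) :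
    Codiff (ZMod 2) where
  toMap := LInfty.pull g d.toMap
  isCoder := d.isCoder.pull hg
  map_one := by
    simp only [LInfty.pull, LinearMap.comp_apply]
    rw [lin_one, d.map_one, map_zero]
  hasDegree := d.hasDegree.pull hg
  sq_zero := by
    ext x
    have := LinearMap.congr_fun d.sq_zero (lin g x)
    simp only [LinearMap.comp_apply, LinearMap.zero_apply] at this
    simp [LInfty.pull, lin_lin_symm, this]

theorem Codiff.equivalent_pull (d : Codiff (ZMod 2)) (g : SW ≃ₗc[ℂ] SW)
    (hg : HasDegree (ZMod 2) (lin g) 0) : d.Equivalent (d.pull g hg) := ⟨g, hg, rfl⟩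

theorem Codiff.ext' {A : Type} [Ring A] {d d' : Codiff A} (h : d.toMap = d'.toMap) : d = d' := by
  cases d
  cases d'
  simp only at h
  subst h
  rfl

theorem Codiff.Equivalent.symm {A : Type} [Ring A] {d d' : Codiff A} (h : d.Equivalent d') :
    d'.Equivalent d := (Codiff.equivalence A).symm h

theorem Codiff.Equivalent.trans {A : Type} [Ring A] {d d' d'' : Codiff A} (h : d.Equivalent d')
    (h' : d'.Equivalent d'') : d.Equivalent d'' := (Codiff.equivalence A).trans h h'

/-! ### Even equivalences between codifferentials of degree one -/

theorem taylor_even {g : SW ≃ₗc[ℂ] SW} (hg : HasDegree (ZMod 2) (lin g) 0) :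
    taylor (mono.coord m₁ ∘ₗ lin g) = ⟨series (mono.coord m₁ ∘ₗ lin g) 0 0, 0, 0,
      series (mono.coord m₁ ∘ₗ lin g) 1 1⟩ ∧
    taylor (mono.coord m₂ ∘ₗ lin g) = ⟨0, series (mono.coord m₂ ∘ₗ lin g) 1 0,
      series (mono.coord m₂ ∘ₗ lin g) 0 1, 0⟩ ∧
    taylor (mono.coord m₃ ∘ₗ lin g) = ⟨0, series (mono.coord m₃ ∘ₗ lin g) 1 0,
      series (mono.coord m₃ ∘ₗ lin g) 0 1, 0⟩ := by
  refine ⟨?_, ?_, ?_⟩ <;> ext1 <;> simp only [taylor] <;>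
    exact series_coord_comp_eq_zero hg (by decide)

theorem entry_one_one_ne_zero {g : SW ≃ₗc[ℂ] SW} (hg : HasDegree (ZMod 2) (lin g) 0) :
    entry (lin g) m₁ m₁ ≠ 0 := by
  rcases exists_entry_lin_ne_zero g (m := m₁) rfl with h | h | h
  · exact h
  · exact absurd (hg _ _ h) (by decide)
  · exact absurd (hg _ _ h) (by decide)

theorem entry_three_three_ne_zero {g : SW ≃ₗc[ℂ] SW} (hg : HasDegree (ZMod 2) (lin g) 0)
    (h0 : entry (lin g) m₂ m₃ = 0) : entry (lin g) m₃ m₃ ≠ 0 := by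
  rcases exists_entry_lin_ne_zero g (m := m₃) rfl with h | h | h
  · exact absurd (hg _ _ h) (by decide)
  · exact absurd h0 h
  · exact h

theorem eq_zero_of_represents {v : OddField} {d : SW →ₗ[ℂ] SW} (h : Represents v.degreeOne d)
    (ha : v.a = 0) (hr : v.r = 0) (hs : v.s = 0) : d = 0 := by
  refine ext_taylor fun ξ => ?_
  rw [h, LinearMap.comp_zero, taylor_zero]
  simp [OddField.act, OddField.degreeOne, ha, hr, hs]

/-- An even automorphism between two nonzero odd vector fields of degree one maps `θ₂` to a multiple
of `θ₂`. Namely, `d θ₂ = 0`, and `d x` is a multiple of `θ₂`; if the image of `θ₂` involved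
`θ₃`, these two conditions would force the vector field to vanish. -/
theorem series_two_three_eq_zero {v v' : OddField} {d d' : SW →ₗ[ℂ] SW}
    (h : Represents v.degreeOne d) (h' : Represents v'.degreeOne d') {g : SW ≃ₗc[ℂ] SW}
    (hg : HasDegree (ZMod 2) (lin g) 0) (hgd : lin g ∘ₗ d' = d ∘ₗ lin g) (hd' : d' ≠ 0) :
    series (mono.coord m₂ ∘ₗ lin g) 0 1 = 0 := by
  by_contra hB
  obtain ⟨t1, t2, -⟩ := taylor_even hg
  have hφ : derivative ℂ (series (mono.coord m₁ ∘ₗ lin g) 0 0) ≠ 0 := by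
    intro h0
    have := congrArg (coeff 0) h0
    rw [coeff_derivative, coeff_series_coord_comp] at this
    exact entry_one_one_ne_zero hg (by simpa [m₁] using this)
  -- the images of `d θ₂ = 0` and of `d x = a θ₂`
  have e2 : (mono.coord m₂ ∘ₗ lin g) ∘ₗ d' = 0 := by
    rw [LinearMap.comp_assoc, hgd, ← LinearMap.comp_assoc]
    have : mono.coord m₂ ∘ₗ d = 0 := by
      apply taylor_injective
      rw [h, taylor_coord_two, taylor_zero]
      simp [OddField.act, OddField.degreeOne]
    rw [this, LinearMap.zero_comp]
  obtain ⟨α, hα⟩ := taylor_surjective ⟨v.a, 0, 0, 0⟩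
  have e1 : (mono.coord m₁ ∘ₗ lin g) ∘ₗ d' = conv (α ∘ₗ lin g) (mono.coord m₂ ∘ₗ lin g) := by
    rw [LinearMap.comp_assoc, hgd, ← LinearMap.comp_assoc, ← conv_comp_lin]
    congr 1
    apply taylor_injective
    rw [h, taylor_coord_one, taylor_conv, hα, taylor_coord_two]
    simp [OddField.act, OddField.degreeOne, SuperFun.mul]
  have e2 := congrArg taylor e2
  have e1 := congrArg taylor e1
  rw [h', t2, taylor_zero] at e2
  rw [h', taylor_conv, t1, t2] at e1
  simp only [OddField.act, OddField.degreeOne, SuperFun.mul, SuperFun.mk.injEq, mul_zero, zero_mul,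
    zero_add, add_zero, neg_zero, map_zero, sub_zero] at e1 e2
  have hr : v'.r = 0 := (mul_eq_zero.mp e2.1).resolve_left hB
  have hα0 : (taylor (α ∘ₗ lin g)).c = 0 := (mul_eq_zero.mp e1.2.2.1.symm).resolve_right hB
  have ha : v'.a = 0 := by
    have := e1.2.1
    rw [hα0, hr] at this
    simpa [hφ] using this
  have hs : v'.s = 0 := by
    have := e2.2.2.2
    rw [ha] at this
    simpa [hB] using this
  exact hd' (eq_zero_of_represents h' ha hr hs)

/-- If `g` maps `θ₂` to a multiple of `θ₂` and `θ₃` to `C θ₂ + D θ₃`, the shear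
`θ₃ ↦ θ₃ - (C / D) θ₂`, after which the image of `θ₃` is `D θ₃`. -/
def straighten (g : SW ≃ₗc[ℂ] SW) : SW ≃ₗc[ℂ] SW :=
  shear (-(series (mono.coord m₃ ∘ₗ lin g) 1 0 * (series (mono.coord m₃ ∘ₗ lin g) 0 1)⁻¹)) 0
    (mul_zero _)

theorem lin_straighten (g : SW ≃ₗc[ℂ] SW) : lin (straighten g) = shearMap
    (-(series (mono.coord m₃ ∘ₗ lin g) 1 0 * (series (mono.coord m₃ ∘ₗ lin g) 0 1)⁻¹)) 0 :=
  lin_shear _ _ _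

theorem hasDegree_straighten {g : SW ≃ₗc[ℂ] SW} (hg : HasDegree (ZMod 2) (lin g) 0)
    (hB : series (mono.coord m₂ ∘ₗ lin g) 0 1 = 0) :
    HasDegree ℤ (lin ((straighten g).trans g)) 0 := by
  obtain ⟨t1, t2, t3⟩ := taylor_even hg
  have hB0 : entry (lin g) m₂ m₃ = 0 := by
    have := congrArg (coeff 0) hB
    rw [coeff_series_coord_comp] at this
    simpa [m₃] using this
  have hD : constantCoeff (series (mono.coord m₃ ∘ₗ lin g) 0 1) ≠ 0 := by
    rw [← coeff_zero_eq_constantCoeff_apply, coeff_series_coord_comp]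
    simpa [m₃] using entry_three_three_ne_zero hg hB0
  rw [straighten]
  refine hasDegree_zero_of_coord ?_ ?_ ?_ <;>
    rw [lin_trans, lin_shear, ← LinearMap.comp_assoc] <;>
    refine isHomog_of_taylor ?_ ?_ ?_ <;>
    rw [taylor_comp_shearMap]
  · simp
  · rw [t1]; simp
  · rw [t1]; simp
  · rw [t2]; simp
  · simp
  · rw [t2, hB]; simp
  · rw [t3]; simp
  · rw [t3]
    intro _
    simp only
    rw [mul_neg, mul_comm (series (mono.coord m₃ ∘ₗ lin g) 1 0), ← mul_assoc,
      PowerSeries.mul_inv_cancel _ hD, one_mul, add_neg_cancel]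
  · simp

theorem pull_straighten {v : OddField} {d : SW →ₗ[ℂ] SW} (h : Represents v.degreeOne d)
    (g : SW ≃ₗc[ℂ] SW) : pull (straighten g) d = d :=
  pull_eq_of_comp_eq (h.shearMap_comm _)

theorem Codiff.represents (d : Codiff ℤ) :
    Represents (fieldOf d.toMap).degreeOne d.toMap := by
  rw [← fieldOf_eq_degreeOne d.hasDegree]
  exact represents_fieldOf d.isCoder d.forget.hasDegree

/-- Evenly equivalent codifferentials of degree one are equivalent in degree zero. -/
theorem Codiff.equivalent_of_forget {d d' : Codiff ℤ} (h : d.forget.Equivalent d'.forget) :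
    d.Equivalent d' := by
  obtain ⟨g, hg, h⟩ := h
  change d'.toMap = LInfty.pull g d.toMap at h
  by_cases h0 : d'.toMap = 0
  · have : d = d' := by
      apply Codiff.ext'
      rw [h0] at h ⊢
      rw [← pull_symm_pull g d.toMap, ← h, LInfty.pull, LinearMap.zero_comp, LinearMap.comp_zero]
    rw [this]
    exact (Codiff.equivalence ℤ).refl d'
  · have hB := series_two_three_eq_zero d.represents d'.represents hg
      (by rw [h, lin_comp_pull]) h0
    refine ⟨(straighten g).trans g, hasDegree_straighten hg hB, ?_⟩
    rw [pull_trans, ← h, pull_straighten d'.represents]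

/-! ### Linear automorphisms -/

/-- The subspace of `S(W)` spanned by the monomials of weight `n`. -/
def weightSpace (n : ℕ) : Submodule ℂ SW := Submodule.span ℂ (mono '' {m | m.weight = n})

theorem mono_mem_weightSpace (m : Mon) : mono m ∈ weightSpace m.weight :=
  Submodule.subset_span ⟨m, rfl, rfl⟩

theorem mem_weightSpace_iff {n : ℕ} {x : SW} :
    x ∈ weightSpace n ↔ ∀ m, mono.repr x m ≠ 0 → m.weight = n := by
  rw [weightSpace, mono.mem_span_image]
  simp [Set.subset_def]

theorem mulSW_mono (m n : Mon) : mulSW (mono m) (mono n) =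
    if m.2.1.val + n.2.1.val ≤ 1 ∧ m.2.2.val + n.2.2.val ≤ 1 then
      ((-1 : ℂ) ^ (m.2.2.val * n.2.1.val)) • mono (m.1 + n.1, m.2.1 + n.2.1, m.2.2 + n.2.2)
    else 0 := by
  simp [mulSW]

theorem mulSW_mem_weightSpace {n n' : ℕ} {u v : SW} (hu : u ∈ weightSpace n)
    (hv : v ∈ weightSpace n') : mulSW u v ∈ weightSpace (n + n') := by
  refine LinearMap.BilinMap.apply_apply_mem_of_mem_span (weightSpace (n + n'))
    (mono '' {m | m.weight = n}) (mono '' {m | m.weight = n'}) mulSW ?_ u v hu hv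
  rintro _ ⟨m, rfl, rfl⟩ _ ⟨m', rfl, rfl⟩
  rw [mulSW_mono]
  split_ifs with h
  · refine Submodule.smul_mem _ _ ?_
    convert mono_mem_weightSpace _ using 2
    simp only [Mon.weight, Fin.val_add]
    rw [Nat.mod_eq_of_lt (by omega), Nat.mod_eq_of_lt (by omega)]
    omega
  · exact Submodule.zero_mem _

theorem lin_mem_weightSpace_one (g : SW ≃ₗc[ℂ] SW) {m : Mon} (hm : m.weight = 1) :
    lin g (mono m) ∈ weightSpace 1 := by
  rw [mem_weightSpace_iff]
  intro m' h'
  have hw := weight_le_of_entry_lin (g := g) (m := m) (m' := m') h'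
  rw [hm] at hw
  refine (Nat.le_one_iff_eq_zero_or_eq_one.mp hw).resolve_left fun h0 => h' ?_
  rw [Mon.weight_eq_zero h0]
  change entry (lin g) 0 m = 0
  rw [entry_lin_zero, if_neg]
  rintro rfl
  simp [Mon.weight] at hm

theorem IsLinearAut.weight_eq {g : SW ≃ₗc[ℂ] SW} (hg : IsLinearAut g) {m m' : Mon}
    (h : entry (lin g) m' m ≠ 0) : m'.weight = m.weight := by
  suffices H : lin g (mono m) ∈ weightSpace m.weight from mem_weightSpace_iff.mp H m' h
  have H0 : ∀ n : ℕ, lin g (mono (n, 0, 0)) ∈ weightSpace n := by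
    intro n
    induction n with
    | zero =>
      rw [show ((0, 0, 0) : Mon) = 0 from rfl, lin_one]
      exact mono_mem_weightSpace 0
    | succ n ih =>
      have : mono (n + 1, 0, 0) = mulSW (mono (n, 0, 0)) (mono m₁) := by simp [mulSW_mono, m₁]
      rw [this, hg]
      exact mulSW_mem_weightSpace ih (lin_mem_weightSpace_one g rfl)
  have H1 : ∀ (n : ℕ) (j : Fin 2), lin g (mono (n, j, 0)) ∈ weightSpace (n + j.val) := by
    intro n j
    fin_cases j
    · exact H0 n
    · have : mono (n, 1, 0) = mulSW (mono (n, 0, 0)) (mono m₂) := by simp [mulSW_mono, m₂]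
      simp only [Fin.mk_one]
      rw [this, hg]
      exact mulSW_mem_weightSpace (H0 n) (lin_mem_weightSpace_one g rfl)
  obtain ⟨n, j, k⟩ := m
  fin_cases k
  · exact H1 n j
  · have : mono (n, j, 1) = mulSW (mono (n, j, 0)) (mono m₃) := by
      simp [mulSW_mono, m₃, Nat.lt_succ_iff.mp j.isLt]
    simp only [Fin.mk_one]
    rw [this, hg]
    exact mulSW_mem_weightSpace (H1 n j) (lin_mem_weightSpace_one g rfl)

theorem IsLinearAut.symm {g : SW ≃ₗc[ℂ] SW} (hg : IsLinearAut g) : IsLinearAut g.symm := by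
  intro u v
  have := hg (lin g.symm u) (lin g.symm v)
  rw [lin_lin_symm, lin_lin_symm] at this
  rw [← this, lin_symm_lin]

theorem IsLinearAut.trans {g h : SW ≃ₗc[ℂ] SW} (hg : IsLinearAut g) (hh : IsLinearAut h) :
    IsLinearAut (h.trans g) := by
  intro u v
  simp only [lin_trans, LinearMap.comp_apply]
  rw [hh, hg]

theorem shearMap_C_mono (s t : ℂ) (m : Mon) : shearMap (C s) (C t) (mono m) = mono m +
    ((if m.2 = (1, 0) then s • mono (m.1, 0, 1) else 0) +
      if m.2 = (0, 1) then t • mono (m.1, 1, 0) else 0) := by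
  have key : ∀ (c : ℂ) (n : ℕ) (F : ℕ → SW), ∑ a ∈ Finset.HasAntidiagonal.antidiagonal n,
      ((n.factorial : ℂ) * ((a.1.factorial : ℂ)⁻¹ * coeff a.2 (C c))) • F a.1 = c • F n := by
    intro c n F
    have h : (n.factorial : ℂ) ≠ 0 := by exact_mod_cast n.factorial_ne_zero
    rw [Finset.sum_eq_single (n, 0)]
    · simp [h]
    · rintro ⟨a, b⟩ hab hne
      simp only [Finset.HasAntidiagonal.mem_antidiagonal] at hab
      have hb : b ≠ 0 := by
        rintro rfl
        exact hne (by simpa using hab)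
      simp [coeff_C, hb]
    · simp
  have k1 := key s m.1 fun n => mono (n, 0, 1)
  have k2 := key t m.1 fun n => mono (n, 1, 0)
  simp only [shearMap, Module.Basis.constr_basis]
  rw [k1, k2]

theorem isLinearAut_shear (s t : ℂ) (h : C s * C t = 0) : IsLinearAut (shear (C s) (C t) h) := by
  have hst : s * t = 0 := by
    have := congrArg constantCoeff h
    simpa using this
  intro u v
  rw [lin_shear]
  suffices H : (mulSW.compr₂ (shearMap (C s) (C t))) =
      mulSW.compl₁₂ (shearMap (C s) (C t)) (shearMap (C s) (C t)) from
    LinearMap.congr_fun (LinearMap.congr_fun H u) v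
  refine mono.ext fun m => mono.ext fun n => ?_
  obtain ⟨n, j, k⟩ := n
  obtain ⟨m, j', k'⟩ := m
  fin_cases j <;> fin_cases k <;> fin_cases j' <;> fin_cases k' <;>
    simp [mulSW_mono, shearMap_C_mono, smul_smul, hst, mul_comm t s]

theorem IsLinearAut.isCochain_pull {g : SW ≃ₗc[ℂ] SW} (hg : IsLinearAut g) {k : ℕ}
    {d : SW →ₗ[ℂ] SW} (hd : IsCochain k d) : IsCochain k (pull g d) := by
  intro m m' hm hm'
  by_contra hne
  obtain ⟨n, h1, h2⟩ := exists_entry_of_comp hne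
  obtain ⟨l, h3, h4⟩ := exists_entry_of_comp h1
  refine h4 (hd l n ?_ ?_)
  · rwa [hg.weight_eq h3]
  · rw [← hg.symm.weight_eq h2, hm']

theorem IsLinearAut.series_eq_C {g : SW ≃ₗc[ℂ] SW} (hg : IsLinearAut g) {m : Mon}
    (hm : m.weight = 1) {j k : Fin 2} (hjk : j.val + k.val = 1) :
    series (mono.coord m ∘ₗ lin g) j k = C (entry (lin g) m (0, j, k)) := by
  ext n
  rw [coeff_series_coord_comp, coeff_C]
  split_ifs with hn
  · subst hn
    simp
  · have : entry (lin g) m (n, j, k) = 0 := by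
      by_contra hne
      have := hg.weight_eq hne
      rw [hm] at this
      simp only [Mon.weight] at this
      omega
    rw [this, zero_div]

theorem isLinearAut_straighten {g : SW ≃ₗc[ℂ] SW} (hg : IsLinearAut g) :
    IsLinearAut (straighten g) := by
  have h : ∀ (κ f : ℂ⟦X⟧) (s t : ℂ) (hκ : κ = C s) (hf : f = C t) (h : κ * f = 0),
      IsLinearAut (shear κ f h) := by
    rintro _ _ s t rfl rfl h
    exact isLinearAut_shear s t h
  refine h _ _ (-(entry (lin g) m₃ m₂ * (entry (lin g) m₃ m₃)⁻¹)) 0 ?_ (by simp) _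
  rw [hg.series_eq_C (m := m₃) rfl (by decide), hg.series_eq_C (m := m₃) rfl (by decide)]
  simp [m₂, m₃, ← C_inv]

/-- The straightening of a linear automorphism has the same diagonal coefficients. -/
theorem entry_straighten_trans {g : SW ≃ₗc[ℂ] SW} (hB : entry (lin g) m₂ m₃ = 0) {m : Mon}
    (hm : m.weight = 1) : entry (lin ((straighten g).trans g)) m m = entry (lin g) m m := by
  have key : ∀ (f : SW →ₗ[ℂ] SW) (m : Mon) (n : ℕ) (j k : Fin 2), entry f m (n, j, k) =
      n.factorial * coeff n (series (mono.coord m ∘ₗ f) j k) := fun f m n j k =>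
    apply_mono_eq (mono.coord m ∘ₗ f) j k n
  have h := taylor_comp_shearMap
    (-(series (mono.coord m₃ ∘ₗ lin g) 1 0 * (series (mono.coord m₃ ∘ₗ lin g) 0 1)⁻¹)) 0
    (mono.coord m ∘ₗ lin g)
  rw [← lin_straighten, LinearMap.comp_assoc, ← lin_trans] at h
  simp only [taylor, mul_zero, add_zero, SuperFun.mk.injEq] at h
  rcases Mon.weight_eq_one hm with rfl | rfl | rfl
  · change entry _ m₁ (1, 0, 0) = entry _ m₁ (1, 0, 0)
    rw [key, key, h.1]
  · change entry _ m₂ (0, 1, 0) = entry _ m₂ (0, 1, 0)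
    have h0 : constantCoeff (series (mono.coord m₂ ∘ₗ lin g) 0 1) = 0 := by
      have := key (lin g) m₂ 0 0 1
      rw [show ((0, 0, 1) : Mon) = m₃ from rfl, hB] at this
      simpa using this.symm
    rw [key, key, h.2.1]
    simp [h0]
  · change entry _ m₃ (0, 0, 1) = entry _ m₃ (0, 0, 1)
    rw [key, key, h.2.2.1]

/-- For a linear automorphism `g`, the image of `d` under `g` has degree one iff `g` maps `e₃` to
a multiple of `e₃`; it is then the image under the straightening of `g`, which has degree zero. -/
theorem hasDegree_pull_linear {d : SW →ₗ[ℂ] SW} (hd : IsOddCoderivation d) (hdeg : HasDegree ℤ d 1)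
    (h0 : d ≠ 0) {g : SW ≃ₗc[ℂ] SW} (hlin : IsLinearAut g) (hg : HasDegree (ZMod 2) (lin g) 0) :
    (HasDegree ℤ (pull g d) 1 ↔ entry (lin g) m₂ m₃ = 0) ∧
    (entry (lin g) m₂ m₃ = 0 → HasDegree ℤ (lin ((straighten g).trans g)) 0 ∧
      pull ((straighten g).trans g) d = pull g d) := by
  have rep : ∀ {d : SW →ₗ[ℂ] SW}, IsOddCoderivation d → HasDegree ℤ d 1 →
      Represents (fieldOf d).degreeOne d := by
    intro d hd hdeg
    rw [← fieldOf_eq_degreeOne hdeg]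
    exact represents_fieldOf hd (hasDegree_two_of_int hdeg)
  have hs : series (mono.coord m₂ ∘ₗ lin g) 0 1 = C (entry (lin g) m₂ m₃) :=
    hlin.series_eq_C rfl (by decide)
  have hmain : entry (lin g) m₂ m₃ = 0 → HasDegree ℤ (lin ((straighten g).trans g)) 0 ∧
      pull ((straighten g).trans g) d = pull g d ∧ HasDegree ℤ (pull g d) 1 := by
    intro hB
    have hg0 := hasDegree_straighten hg (by rw [hs, hB, map_zero])
    have hp := hdeg.pull hg0
    -- the shear `straighten g` commutes with its own pullback of `pull g d`, which has degree one
    have hc := (rep (hd.pull (by simpa using hg0.cast (A := ZMod 2))) hp).shearMap_comm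
      (-(series (mono.coord m₃ ∘ₗ lin g) 1 0 * (series (mono.coord m₃ ∘ₗ lin g) 0 1)⁻¹))
    rw [← lin_straighten, pull_trans] at hc
    have he : pull ((straighten g).trans g) d = pull g d := by
      rw [pull_trans, ← LinearMap.comp_id (pull (straighten g) (pull g d)),
        ← lin_comp_lin_symm (straighten g), ← LinearMap.comp_assoc, hc, lin_comp_pull,
        LinearMap.comp_assoc, lin_comp_lin_symm, LinearMap.comp_id]
    rw [he] at hp
    exact ⟨hg0, he, hp⟩
  refine ⟨⟨fun h => ?_, fun h => (hmain h).2.2⟩, fun h => ⟨(hmain h).1, (hmain h).2.1⟩⟩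
  have hne : pull g d ≠ 0 := by
    intro he
    apply h0
    rw [← pull_symm_pull g d, he, pull, LinearMap.zero_comp, LinearMap.comp_zero]
  have := series_two_three_eq_zero (rep hd hdeg) (rep (hd.pull hg) h) hg (lin_comp_pull g d) hne
  rw [hs] at this
  simpa using congrArg constantCoeff this

/-! ### Removing the part of degree minus one -/

theorem exists_eq_mul_of_coeff {u w : ℂ⟦X⟧} {n : ℕ} (hu : ∀ i < n, coeff i u = 0)
    (hw : ∀ i < n, coeff i w = 0) (hn : coeff n u ≠ 0) : ∃ f, w = f * u := by
  obtain ⟨u', rfl⟩ := X_pow_dvd_iff.mpr hu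
  obtain ⟨w', rfl⟩ := X_pow_dvd_iff.mpr hw
  have h0 : constantCoeff u' ≠ 0 := by
    have := coeff_X_pow_mul u' n 0
    rw [zero_add] at this
    rwa [this, coeff_zero_eq_constantCoeff_apply] at hn
  refine ⟨w' * u'⁻¹, ?_⟩
  rw [mul_left_comm, mul_assoc, PowerSeries.inv_mul_cancel _ h0, mul_one]

/-- The condition on the vector field `v` under which the shear `θ₂ ↦ θ₂ + f θ₃` removes its part
of degree minus one. -/
def OddField.IsStraightenedBy (v : OddField) (f : ℂ⟦X⟧) : Prop :=
  v.p = f * v.r ∧ v.b = -(f * v.a) ∧ v.q = f * v.s + derivative ℂ f * v.a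

/-- For a vector field of square zero, the first nonzero one among the pairs `(r, p)`, `(a, b)`,
`(s, q)` decides: if its second entry is a multiple of the first, the other relations
follow from `d² = 0`. -/
theorem Represents.exists_isStraightenedBy {v : OddField} {d : SW →ₗ[ℂ] SW} (h : Represents v d)
    (hd : d ∘ₗ d = 0)
    (hv : (v.r ≠ 0 ∧ ∃ f, v.p = f * v.r) ∨
      (v.r = 0 ∧ v.p = 0 ∧ v.a ≠ 0 ∧ ∃ f, v.b = f * v.a) ∨
      (v.r = 0 ∧ v.p = 0 ∧ v.a = 0 ∧ v.b = 0 ∧ ∃ f, v.q = f * v.s)) :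
    ∃ f, v.IsStraightenedBy f := by
  obtain ⟨h1, h2, h3, h4, -, -⟩ := h.sq_zero_relations hd
  rcases hv with ⟨hr, f, hf⟩ | ⟨hr, hp, ha, f, hf⟩ | ⟨hr, hp, ha, hb, f, hf⟩
  · refine ⟨f, hf, ?_, ?_⟩
    · apply mul_right_cancel₀ hr
      rw [hf] at h1
      linear_combination h1
    · apply mul_right_cancel₀ hr
      rw [hf, Derivation.leibniz] at h3
      simp only [smul_eq_mul] at h3
      linear_combination -h3 + f * h4
  · refine ⟨-f, by rw [hp, hr, mul_zero], by rw [hf]; ring, ?_⟩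
    apply mul_right_cancel₀ ha
    rw [hf, Derivation.leibniz] at h2
    simp only [smul_eq_mul] at h2
    rw [map_neg]
    linear_combination h2
  · exact ⟨f, by rw [hp, hr, mul_zero], by rw [ha, hb, mul_zero, neg_zero],
      by rw [hf, ha, mul_zero, add_zero]⟩

/-- The vector field `v` in the coordinates `x`, `θ₂`, `θ₃ - t θ₂`. -/
def OddField.tilt (v : OddField) (t : ℂ) : OddField :=
  ⟨v.a + C t * v.b, v.b, v.p, v.q, v.r - C t * v.p, v.s - C t * v.q⟩

/-- The automorphism of `S(W)` with transpose `θ₃ ↦ θ₃ + t θ₂`. -/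
def tiltAut (t : ℂ) : SW ≃ₗc[ℂ] SW := shear (C t) (C 0) (by simp)

theorem hasDegree_tiltAut (t : ℂ) : HasDegree (ZMod 2) (lin (tiltAut t)) 0 := hasDegree_shear _ _ _

theorem Represents.pull_tiltAut {v : OddField} {d : SW →ₗ[ℂ] SW} (h : Represents v d) (t : ℂ) :
    Represents (v.tilt t) (pull (tiltAut t) d) := by
  intro ξ
  have e : ξ ∘ₗ pull (tiltAut t) d =
      ((ξ ∘ₗ shearMap (-C t) (-C 0)) ∘ₗ d) ∘ₗ shearMap (C t) (C 0) := by
    rw [pull, tiltAut, lin_shear, lin_shear_symm, LinearMap.comp_assoc, LinearMap.comp_assoc]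
  rw [e, taylor_comp_shearMap, h, taylor_comp_shearMap]
  ext1 <;> simp [OddField.act, OddField.tilt] <;> ring

/-- The part of degree one of `d` in the coordinates `x`, `θ₂`, `θ₃ - t θ₂`. -/
def Codiff.tiltPart (d : Codiff (ZMod 2)) (t : ℂ) : Codiff ℤ :=
  (d.pull (tiltAut t) (hasDegree_tiltAut t)).part

theorem pull_shear_eq_degreeOnePart {v : OddField} {d : SW →ₗ[ℂ] SW} (h : Represents v d)
    {f : ℂ⟦X⟧} (hf : v.IsStraightenedBy f) (κ : ℂ⟦X⟧) (hκ : κ = 0) :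
    pull (shear κ f (by rw [hκ, zero_mul])) d = degreeOnePart d := by
  subst hκ
  exact pull_eq_of_comp_eq (h.comp_shearMap hf.1 hf.2.1 hf.2.2)

theorem Codiff.equivalent_tiltPart {d : Codiff (ZMod 2)} {t : ℂ}
    (h : ∃ f, ((fieldOf d.toMap).tilt t).IsStraightenedBy f) :
    (d.tiltPart t).forget.Equivalent d := by
  obtain ⟨f, hf⟩ := h
  have hr := (represents_fieldOf d.isCoder d.hasDegree).pull_tiltAut t
  refine Codiff.Equivalent.symm ((d.equivalent_pull _ (hasDegree_tiltAut t)).trans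
    ⟨shear 0 f (zero_mul f), hasDegree_shear _ _ _, ?_⟩)
  exact (pull_shear_eq_degreeOnePart hr hf 0 rfl).symm

/-- The tilt by any `t` does not change the codifferentials of degree one. -/
theorem Codiff.tiltPart_forget (d : Codiff ℤ) (t : ℂ) : d.forget.tiltPart t = d := by
  apply Codiff.ext'
  have h : LInfty.pull (tiltAut t) d.toMap = d.toMap := by
    refine pull_eq_of_comp_eq ?_
    rw [tiltAut, lin_shear, map_zero]
    exact d.represents.shearMap_comm _
  change degreeOnePart (LInfty.pull (tiltAut t) d.toMap) = d.toMap
  rw [h, degreeOnePart_eq_self d.hasDegree]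

/-- A sufficient condition, in terms of the leading coefficients, for the tilt by `t` to be
removable. -/
theorem Codiff.exists_tilt_isStraightenedBy (d : Codiff (ZMod 2)) {v : OddField}
    (hv : v = fieldOf d.toMap) (t : ℂ)
    (h : (∃ n, (∀ i < n, coeff i v.r = 0 ∧ coeff i v.p = 0) ∧
        coeff n v.r - t * coeff n v.p ≠ 0) ∨
      (v.r = 0 ∧ v.p = 0 ∧ ∃ n, (∀ i < n, coeff i v.a = 0 ∧ coeff i v.b = 0) ∧
        coeff n v.a + t * coeff n v.b ≠ 0) ∨
      (v.r = 0 ∧ v.p = 0 ∧ v.a = 0 ∧ v.b = 0 ∧ ∃ n,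
        (∀ i < n, coeff i v.s = 0 ∧ coeff i v.q = 0) ∧ coeff n v.s - t * coeff n v.q ≠ 0) ∨
      (v.r = 0 ∧ v.p = 0 ∧ v.a = 0 ∧ v.b = 0 ∧ v.s = 0 ∧ v.q = 0)) :
    ∃ f, (v.tilt t).IsStraightenedBy f := by
  have hr := (represents_fieldOf d.isCoder d.hasDegree).pull_tiltAut t
  rw [← hv] at hr
  refine hr.exists_isStraightenedBy (d.pull (tiltAut t) (hasDegree_tiltAut t)).sq_zero ?_
  rcases h with ⟨n, hlt, hn⟩ | ⟨h1, h2, n, hlt, hn⟩ | ⟨h1, h2, h3, h4, n, hlt, hn⟩ |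
    ⟨h1, h2, h3, h4, h5, h6⟩
  · have hn' : coeff n (v.tilt t).r ≠ 0 := by simpa [OddField.tilt] using hn
    refine Or.inl ⟨fun h0 => hn' (by rw [h0, map_zero]), exists_eq_mul_of_coeff (n := n) ?_ ?_ hn'⟩
    · intro i hi
      simp [OddField.tilt, (hlt i hi).1, (hlt i hi).2]
    · exact fun i hi => (hlt i hi).2
  · have hn' : coeff n (v.tilt t).a ≠ 0 := by simpa [OddField.tilt] using hn
    refine Or.inr (Or.inl ⟨by simp [OddField.tilt, h1, h2], h2,
      fun h0 => hn' (by rw [h0, map_zero]), exists_eq_mul_of_coeff (n := n) ?_ ?_ hn'⟩)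
    · intro i hi
      simp [OddField.tilt, (hlt i hi).1, (hlt i hi).2]
    · exact fun i hi => (hlt i hi).2
  · have hn' : coeff n (v.tilt t).s ≠ 0 := by simpa [OddField.tilt] using hn
    refine Or.inr (Or.inr ⟨by simp [OddField.tilt, h1, h2], h2, by simp [OddField.tilt, h3, h4], h4,
      exists_eq_mul_of_coeff (n := n) ?_ ?_ hn'⟩)
    · intro i hi
      simp [OddField.tilt, (hlt i hi).1, (hlt i hi).2]
    · exact fun i hi => (hlt i hi).2
  · exact Or.inr (Or.inr ⟨by simp [OddField.tilt, h1, h2], h2, by simp [OddField.tilt, h3, h4], h4,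
      0, by simp [OddField.tilt, h6]⟩)

/-! ### Holomorphic families -/

/-- Of a nonzero pair of sequences of holomorphic functions, the first nonzero members `u n, w n`
have a linear combination `u n + t w n` without zeros in a punctured neighbourhood of `0`. -/
theorem exists_leading_coefficient {ρ : ℝ} (hρ : 0 < ρ) (u w : ℕ → ℂ → ℂ)
    (hu : ∀ n, DifferentiableOn ℂ (u n) (Metric.ball 0 ρ))
    (hw : ∀ n, DifferentiableOn ℂ (w n) (Metric.ball 0 ρ)) :
    (∀ n, ∀ τ ∈ Metric.ball (0 : ℂ) ρ, u n τ = 0 ∧ w n τ = 0) ∨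
    ∃ (n : ℕ) (t : ℂ), (∀ i < n, ∀ τ ∈ Metric.ball (0 : ℂ) ρ, u i τ = 0 ∧ w i τ = 0) ∧
      ∀ᶠ τ in 𝓝[≠] (0 : ℂ), u n τ + t * w n τ ≠ 0 := by
  classical
  have hid : ∀ f : ℂ → ℂ, DifferentiableOn ℂ f (Metric.ball 0 ρ) →
      (∃ τ ∈ Metric.ball (0 : ℂ) ρ, f τ ≠ 0) → ∀ᶠ τ in 𝓝[≠] (0 : ℂ), f τ ≠ 0 := by
    rintro f hf ⟨τ, hτ, hne⟩
    have han : AnalyticOnNhd ℂ f (Metric.ball 0 ρ) := hf.analyticOnNhd Metric.isOpen_ball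
    have h0 : (0 : ℂ) ∈ Metric.ball (0 : ℂ) ρ := Metric.mem_ball_self hρ
    rcases (han 0 h0).eventually_eq_zero_or_eventually_ne_zero with h | h
    · exact absurd (han.eqOn_zero_of_preconnected_of_eventuallyEq_zero
        (convex_ball _ _).isPreconnected h0 h hτ) hne
    · exact h
  rw [or_iff_not_imp_left]
  intro hex
  have hex : ∃ n, ¬ ∀ τ ∈ Metric.ball (0 : ℂ) ρ, u n τ = 0 ∧ w n τ = 0 := by
    by_contra! hcon
    exact hex hcon
  obtain ⟨n, hn, hlt⟩ : ∃ n, (¬ ∀ τ ∈ Metric.ball (0 : ℂ) ρ, u n τ = 0 ∧ w n τ = 0) ∧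
      ∀ i < n, ∀ τ ∈ Metric.ball (0 : ℂ) ρ, u i τ = 0 ∧ w i τ = 0 :=
    ⟨Nat.find hex, Nat.find_spec hex, fun i hi => not_not.mp (Nat.find_min hex hi)⟩
  by_cases h : ∃ τ ∈ Metric.ball (0 : ℂ) ρ, u n τ ≠ 0
  · refine ⟨n, 0, hlt, ?_⟩
    simpa using hid _ (hu _) h
  · refine ⟨n, 1, hlt, ?_⟩
    have h' : ∃ τ ∈ Metric.ball (0 : ℂ) ρ, u n τ + w n τ ≠ 0 := by
      by_contra! hcon
      refine hn fun τ hτ => ?_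
      have h0 : u n τ = 0 := by
        by_contra hne
        exact h ⟨τ, hτ, hne⟩
      exact ⟨h0, by simpa [h0] using hcon τ hτ⟩
    simpa using hid _ ((hu _).add (hw _)) h'

/-- One tilt works for all small nonzero parameters of a holomorphic family. -/
theorem exists_tilt_of_family (D : ℂ → Codiff (ZMod 2)) {ρ : ℝ} (hρ : 0 < ρ)
    (hD : ∀ m m' : Mon,
      DifferentiableOn ℂ (fun τ => entry (D τ).toMap m' m) (Metric.ball 0 ρ)) :
    ∃ t : ℂ, ∀ᶠ τ in 𝓝[≠] (0 : ℂ), ∃ f, ((fieldOf (D τ).toMap).tilt t).IsStraightenedBy f := by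
  have hdiff : ∀ (m : Mon) (j k : Fin 2) (n : ℕ), DifferentiableOn ℂ
      (fun τ => coeff n (series (mono.coord m ∘ₗ (D τ).toMap) j k)) (Metric.ball 0 ρ) := by
    intro m j k n
    simp only [coeff_series_coord_comp]
    exact (hD _ _).div_const _
  have hball : ∀ᶠ τ in 𝓝[≠] (0 : ℂ), τ ∈ Metric.ball (0 : ℂ) ρ :=
    nhdsWithin_le_nhds (Metric.ball_mem_nhds _ hρ)
  rcases exists_leading_coefficient hρ (fun n τ => coeff n (fieldOf (D τ).toMap).r)
    (fun n τ => -coeff n (fieldOf (D τ).toMap).p) (hdiff _ _ _)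
    (fun n => (hdiff _ _ _ n).neg) with
    h1 | ⟨n, t, hlt, hn⟩
  swap
  · refine ⟨t, ?_⟩
    filter_upwards [hball, hn] with τ hτ hne
    refine (D τ).exists_tilt_isStraightenedBy rfl t (Or.inl ⟨n, fun i hi => ?_, ?_⟩)
    · simpa using hlt i hi τ hτ
    · simpa [sub_eq_add_neg] using hne
  have hr : ∀ τ ∈ Metric.ball (0 : ℂ) ρ, (fieldOf (D τ).toMap).r = 0 := fun τ hτ =>
    PowerSeries.ext fun n => by simpa using (h1 n τ hτ).1
  have hp : ∀ τ ∈ Metric.ball (0 : ℂ) ρ, (fieldOf (D τ).toMap).p = 0 := fun τ hτ =>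
    PowerSeries.ext fun n => by simpa using (h1 n τ hτ).2
  rcases exists_leading_coefficient hρ (fun n τ => coeff n (fieldOf (D τ).toMap).a)
    (fun n τ => coeff n (fieldOf (D τ).toMap).b) (hdiff _ _ _) (hdiff _ _ _) with
    h2 | ⟨n, t, hlt, hn⟩
  swap
  · refine ⟨t, ?_⟩
    filter_upwards [hball, hn] with τ hτ hne
    exact (D τ).exists_tilt_isStraightenedBy rfl t
      (Or.inr (Or.inl ⟨hr τ hτ, hp τ hτ, n, fun i hi => hlt i hi τ hτ, hne⟩))
  have ha : ∀ τ ∈ Metric.ball (0 : ℂ) ρ, (fieldOf (D τ).toMap).a = 0 := fun τ hτ =>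
    PowerSeries.ext fun n => by simpa using (h2 n τ hτ).1
  have hb : ∀ τ ∈ Metric.ball (0 : ℂ) ρ, (fieldOf (D τ).toMap).b = 0 := fun τ hτ =>
    PowerSeries.ext fun n => by simpa using (h2 n τ hτ).2
  rcases exists_leading_coefficient hρ (fun n τ => coeff n (fieldOf (D τ).toMap).s)
    (fun n τ => -coeff n (fieldOf (D τ).toMap).q) (hdiff _ _ _)
    (fun n => (hdiff _ _ _ n).neg) with
    h3 | ⟨n, t, hlt, hn⟩
  swap
  · refine ⟨t, ?_⟩
    filter_upwards [hball, hn] with τ hτ hne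
    refine (D τ).exists_tilt_isStraightenedBy rfl t (Or.inr (Or.inr (Or.inl
      ⟨hr τ hτ, hp τ hτ, ha τ hτ, hb τ hτ, n, fun i hi => ?_, ?_⟩)))
    · simpa using hlt i hi τ hτ
    · simpa [sub_eq_add_neg] using hne
  refine ⟨0, ?_⟩
  filter_upwards [hball] with τ hτ
  refine (D τ).exists_tilt_isStraightenedBy rfl 0 (Or.inr (Or.inr (Or.inr
    ⟨hr τ hτ, hp τ hτ, ha τ hτ, hb τ hτ, ?_, ?_⟩)))
  · exact PowerSeries.ext fun n => by simpa using (h3 n τ hτ).1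
  · exact PowerSeries.ext fun n => by simpa using (h3 n τ hτ).2

theorem Codiff.exists_tilt (d : Codiff (ZMod 2)) :
    ∃ t f, ((fieldOf d.toMap).tilt t).IsStraightenedBy f := by
  -- the tilt that serves the constant family with value `d`
  obtain ⟨t, ht⟩ := exists_tilt_of_family (fun _ => d) one_pos
    fun _ _ => differentiableOn_const _
  exact ⟨t, ht.exists.choose_spec⟩

theorem Codiff.exists_forget_equivalent (d : Codiff (ZMod 2)) :
    ∃ d' : Codiff ℤ, d'.forget.Equivalent d := by
  obtain ⟨t, ht⟩ := d.exists_tilt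
  exact ⟨d.tiltPart t, Codiff.equivalent_tiltPart ht⟩

theorem moduliMap_bijective : Function.Bijective moduliMap := by
  constructor
  · intro x y
    induction x using Quotient.inductionOn
    induction y using Quotient.inductionOn
    intro h
    exact Quotient.sound (Codiff.equivalent_of_forget (Quotient.exact h))
  · intro y
    induction y using Quotient.inductionOn with
    | h d =>
      obtain ⟨d', h⟩ := d.exists_forget_equivalent
      exact ⟨Quotient.mk _ d', Quotient.sound h⟩

/-! ### Homogeneous codifferentials -/

theorem coeff_mul_of_lower {u : ℂ⟦X⟧} {n : ℕ} (h : ∀ i < n, coeff i u = 0) (f : ℂ⟦X⟧) :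
    coeff n (f * u) = constantCoeff f * coeff n u := by
  obtain ⟨u', rfl⟩ := X_pow_dvd_iff.mpr h
  rw [mul_left_comm]
  have := fun u => coeff_X_pow_mul u n 0 (R := ℂ)
  simp only [zero_add] at this
  rw [this, this]
  simp

/-- For `d ∈ C^k` the series `p, r`, `a, b` and `q, s` are monomials of degrees `k`, `k - 1` and
`k - 2`, so the power series `f` can be replaced by its constant coefficient. -/
theorem IsCochain.isStraightenedBy_C {k : ℕ} {d : SW →ₗ[ℂ] SW} (hd : IsCochain k d) {t : ℂ}
    {f : ℂ⟦X⟧} (hf : ((fieldOf d).tilt t).IsStraightenedBy f) :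
    ((fieldOf d).tilt t).IsStraightenedBy (C (constantCoeff f)) := by
  set v := (fieldOf d).tilt t with hv
  have hs : ∀ (m : Mon) (j l : Fin 2) (n : ℕ), m.weight = 1 → n + j.val + l.val ≠ k →
      coeff n (series (mono.coord m ∘ₗ d) j l) = 0 := by
    intro m j l n hm hn
    rw [coeff_series_coord_comp, hd (n, j, l) m hn hm, zero_div]
  have ha : ∀ n, n + 1 ≠ k → coeff n v.a = 0 ∧ coeff n v.b = 0 := by
    intro n hn
    have h1 := hs m₁ 1 0 n rfl (by simpa using hn)
    have h2 := hs m₁ 0 1 n rfl (by simpa using hn)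
    simp [hv, OddField.tilt, fieldOf, h1, h2]
  have hr : ∀ n, n ≠ k → coeff n v.r = 0 ∧ coeff n v.p = 0 := by
    intro n hn
    have h1 := hs m₃ 0 0 n rfl (by simpa using hn)
    have h2 := hs m₂ 0 0 n rfl (by simpa using hn)
    simp [hv, OddField.tilt, fieldOf, h1, h2]
  have hq : ∀ n, n + 2 ≠ k → coeff n v.s = 0 ∧ coeff n v.q = 0 := by
    intro n hn
    have h1 := hs m₃ 1 1 n rfl (by simpa using hn)
    have h2 := hs m₂ 1 1 n rfl (by simpa using hn)
    simp [hv, OddField.tilt, fieldOf, h1, h2]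
  obtain ⟨h1, h2, h3⟩ := hf
  refine ⟨?_, ?_, ?_⟩
  · ext n
    by_cases hn : n = k
    · rw [h1, coeff_C_mul, coeff_mul_of_lower fun i hi => (hr i (by omega)).1]
    · rw [coeff_C_mul, (hr n hn).1, (hr n hn).2, mul_zero]
  · ext n
    by_cases hn : n + 1 = k
    · rw [h2, map_neg, map_neg, coeff_C_mul, coeff_mul_of_lower fun i hi => (ha i (by omega)).1]
    · rw [map_neg, coeff_C_mul, (ha n hn).1, (ha n hn).2, mul_zero, neg_zero]
  · ext n
    rw [derivative_C, zero_mul, add_zero]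
    by_cases hn : n + 2 = k
    · rw [h3, map_add, coeff_C_mul, coeff_mul_of_lower fun i hi => (hq i (by omega)).1,
        coeff_mul_of_lower fun i hi => (ha i (by omega)).1, (ha n (by omega)).1, mul_zero, add_zero]
    · rw [coeff_C_mul, (hq n hn).1, (hq n hn).2, mul_zero]

theorem Codiff.exists_linearAut {k : ℕ} (d : Codiff (ZMod 2)) (hd : IsCochain k d.toMap) :
    ∃ g : SW ≃ₗc[ℂ] SW, IsLinearAut g ∧ HasDegree (ZMod 2) (lin g) 0 ∧
      IsCochain k (LInfty.pull g d.toMap) ∧ HasDegree ℤ (LInfty.pull g d.toMap) 1 := by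
  obtain ⟨t, f, hf⟩ := d.exists_tilt
  have hf := hd.isStraightenedBy_C hf
  have hr := (represents_fieldOf d.isCoder d.hasDegree).pull_tiltAut t
  have hlin : IsLinearAut ((shear (C 0) (C (constantCoeff f)) (by simp)).trans (tiltAut t)) :=
    (isLinearAut_shear _ _ _).trans (isLinearAut_shear _ _ _)
  refine ⟨_, hlin, ?_, hlin.isCochain_pull hd, ?_⟩
  · have := (hasDegree_tiltAut t).comp (hasDegree_shear (C 0) (C (constantCoeff f)) (by simp))
    rwa [add_zero] at this
  · rw [pull_trans, pull_shear_eq_degreeOnePart hr hf (C 0) (map_zero _)]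
    exact hasDegree_degreeOnePart _

/-! ### Deformations -/

theorem IsDeformation.forget {d : Codiff ℤ} {E : ℂ → Codiff ℤ} (h : IsDeformation d E) :
    IsDeformation d.forget fun τ => (E τ).forget :=
  ⟨congrArg Codiff.forget h.1, h.2⟩

theorem differentiableOn_entry_pull {D : ℂ → Codiff (ZMod 2)} {s : Set ℂ}
    (hD : ∀ m m' : Mon, DifferentiableOn ℂ (fun τ => entry (D τ).toMap m' m) s)
    (g : SW ≃ₗc[ℂ] SW) (m m' : Mon) :
    DifferentiableOn ℂ (fun τ => entry (pull g (D τ).toMap) m' m) s := by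
  -- no map involved raises the weight, so all sums are over the monomials up to the weight of `m`
  let F : Finset Mon := Finset.range (m.weight + 1) ×ˢ Finset.univ
  have hF : ∀ n : Mon, n.weight ≤ m.weight → n ∈ F := by
    intro n hn
    simp only [F, Finset.mem_product, Finset.mem_range, Finset.mem_univ, and_true]
    simp only [Mon.weight] at hn ⊢
    omega
  have h1 : ∀ τ n, entry ((D τ).toMap ∘ₗ lin g) n m =
      ∑ l ∈ F, entry (lin g) l m * entry (D τ).toMap n l := fun τ n =>
    entry_comp _ _ _ _ fun l hl => hF l (weight_le_of_entry_lin hl)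
  have h2 : ∀ τ, entry (pull g (D τ).toMap) m' m =
      ∑ n ∈ F, entry ((D τ).toMap ∘ₗ lin g) n m * entry (lin g.symm) m' n := by
    refine fun τ => entry_comp _ _ _ _ fun n hn => hF n ?_
    obtain ⟨l, hl, hl'⟩ := exists_entry_of_comp hn
    exact (weight_le_of_entry_coderivation (D τ).isCoder (D τ).map_one hl').trans
      (weight_le_of_entry_lin hl)
  simp only [h2, h1]
  exact DifferentiableOn.fun_sum fun n _ => (DifferentiableOn.fun_sum fun l _ =>
    (hD l n).const_mul _).mul_const _

theorem IsDeformation.pull {d : Codiff (ZMod 2)} {D : ℂ → Codiff (ZMod 2)} (h : IsDeformation d D)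
    (g : SW ≃ₗc[ℂ] SW) (hg : HasDegree (ZMod 2) (lin g) 0) :
    IsDeformation (d.pull g hg) fun τ => (D τ).pull g hg := by
  obtain ⟨h0, ρ, hρ, hD⟩ := h
  exact ⟨congrArg (fun d => d.pull g hg) h0, ρ, hρ, differentiableOn_entry_pull hD g⟩

/-- A `ℤ₂`-graded family of deformations of a `ℤ`-graded codifferential is pointwise equivalent to
a `ℤ`-graded one: tilt the coordinates generically, and take the part of degree one. At the
parameter `0` neither step changes anything. -/
theorem IsDeformation.exists_int {d : Codiff ℤ} {D : ℂ → Codiff (ZMod 2)}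
    (h : IsDeformation d.forget D) : ∃ E : ℂ → Codiff ℤ, IsDeformation d E ∧
      ∀ᶠ τ in 𝓝 (0 : ℂ), (E τ).forget.Equivalent (D τ) := by
  obtain ⟨h0, ρ, hρ, hD⟩ := h
  obtain ⟨t, ht⟩ := exists_tilt_of_family D hρ hD
  refine ⟨fun τ => (D τ).tiltPart t, ⟨?_, ρ, hρ, fun m m' => ?_⟩, ?_⟩
  · simp only
    rw [h0, Codiff.tiltPart_forget]
  · have : ∀ τ, entry ((D τ).tiltPart t).toMap m' m =
        if m'.deg = m.deg + 1 then entry (LInfty.pull (tiltAut t) (D τ).toMap) m' m else 0 :=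
      fun τ => entry_degreeOnePart _ _ _
    simp only [this]
    split_ifs
    · exact differentiableOn_entry_pull hD _ m m'
    · exact differentiableOn_const _
  · rw [eventually_nhdsWithin_iff] at ht
    filter_upwards [ht] with τ hτ
    by_cases h' : τ = 0
    · subst h'
      rw [h0, Codiff.tiltPart_forget]
      exact (Codiff.equivalence _).refl _
    · exact Codiff.equivalent_tiltPart (hτ h')

theorem hasJump_forget_iff (d d' : Codiff ℤ) : HasJump d d' ↔ HasJump d.forget d'.forget := by
  constructor
  · rintro ⟨hne, E, hE, hj⟩
    refine ⟨fun h => hne (Codiff.equivalent_of_forget h), _, hE.forget, ?_⟩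
    filter_upwards [hj] with τ hτ
    exact hτ.forget
  · rintro ⟨hne, D, hD, hj⟩
    obtain ⟨E, hE, hED⟩ := hD.exists_int
    refine ⟨fun h => hne h.forget, E, hE, ?_⟩
    filter_upwards [hj, nhdsWithin_le_nhds hED] with τ h1 h2
    exact Codiff.equivalent_of_forget (h2.trans h1)

theorem isSmoothFamily_forget_iff (E : ℂ → Codiff ℤ) :
    IsSmoothFamily E ↔ IsSmoothFamily fun τ => (E τ).forget := by
  refine not_congr ⟨?_, ?_⟩
  · rintro ⟨d', h⟩
    refine ⟨d'.forget, ?_⟩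
    filter_upwards [h] with τ hτ
    exact hτ.forget
  · rintro ⟨D', h⟩
    obtain ⟨d', hd'⟩ := D'.exists_forget_equivalent
    refine ⟨d', ?_⟩
    filter_upwards [h] with τ hτ
    exact Codiff.equivalent_of_forget (hτ.trans hd'.symm)

theorem factorsThroughJump_forget_iff (d : Codiff ℤ) (E : ℂ → Codiff ℤ) :
    FactorsThroughJump d E ↔ FactorsThroughJump d.forget fun τ => (E τ).forget := by
  constructor
  · rintro ⟨d', hj, E', hE', h⟩
    refine ⟨d'.forget, (hasJump_forget_iff d d').mp hj, _, hE'.forget, ?_⟩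
    filter_upwards [h] with τ hτ
    exact hτ.forget
  · rintro ⟨D', ⟨hne, D, hD, hj⟩, F, hF, h⟩
    -- move the codifferential `D'`, and the family `F` with it, to a `ℤ`-graded codifferential
    obtain ⟨d', hd'⟩ := D'.exists_forget_equivalent
    obtain ⟨g, hg, hgd⟩ := hd'.symm
    have hpull : D'.pull g hg = d'.forget := Codiff.ext' hgd.symm
    have hF' := hF.pull g hg
    rw [hpull] at hF'
    obtain ⟨E', hE', hEF⟩ := hF'.exists_int
    refine ⟨d', (hasJump_forget_iff d d').mpr ⟨fun h => hne (h.trans hd'), D, hD, ?_⟩, E', hE', ?_⟩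
    · filter_upwards [hj] with τ hτ
      exact hτ.trans hd'.symm
    · filter_upwards [h, nhdsWithin_le_nhds hEF] with τ h1 h2
      exact Codiff.equivalent_of_forget
        (h2.trans (((F τ).equivalent_pull g hg).symm.trans h1))

end LInfty

end

theorem mainTheorem2 :
    -- the natural map of moduli spaces is a bijection
    Function.Bijective LInfty.moduliMap ∧
    -- an odd codifferential of degree `k` can be moved into `C^k_1` by an even linear automorphism
    (∀ (k : ℕ) (d : LInfty.Codiff (ZMod 2)), LInfty.IsCochain k d.toMap →
      ∃ g : LInfty.SW ≃ₗc[ℂ] LInfty.SW, LInfty.IsLinearAut g ∧ LInfty.HasDegree (ZMod 2) (LInfty.lin g) 0 ∧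
        LInfty.IsCochain k (LInfty.pull g d.toMap) ∧
        LInfty.HasDegree ℤ (LInfty.pull g d.toMap) 1) ∧
    -- even linear automorphisms on nonzero elements of `C^k_1`
    (∀ (k : ℕ), 1 ≤ k → ∀ d : LInfty.SW →ₗ[ℂ] LInfty.SW, LInfty.IsOddCoderivation d →
      LInfty.IsCochain k d → LInfty.HasDegree ℤ d 1 → d ≠ 0 →
      ∀ g : LInfty.SW ≃ₗc[ℂ] LInfty.SW, LInfty.IsLinearAut g →
        LInfty.HasDegree (ZMod 2) (LInfty.lin g) 0 →
        (LInfty.HasDegree ℤ (LInfty.pull g d) 1 ↔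
          LInfty.entry (LInfty.lin g) LInfty.m₂ LInfty.m₃ = 0) ∧
        (LInfty.HasDegree ℤ (LInfty.pull g d) 1 →
          ∃ g₀ : LInfty.SW ≃ₗc[ℂ] LInfty.SW, LInfty.IsLinearAut g₀ ∧
            LInfty.HasDegree ℤ (LInfty.lin g₀) 0 ∧
            (∀ m : LInfty.Mon, m.weight = 1 →
              LInfty.entry (LInfty.lin g₀) m m = LInfty.entry (LInfty.lin g) m m) ∧
            LInfty.pull g₀ d = LInfty.pull g d)) ∧
    -- the deformations agree
    (∀ d : LInfty.Codiff ℤ,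
      (∀ E : ℂ → LInfty.Codiff ℤ, LInfty.IsDeformation d E →
        LInfty.IsDeformation d.forget (fun t => (E t).forget) ∧
        (LInfty.IsSmoothFamily E ↔ LInfty.IsSmoothFamily (fun t => (E t).forget)) ∧
        (LInfty.FactorsThroughJump d E ↔
          LInfty.FactorsThroughJump d.forget (fun t => (E t).forget))) ∧
      (∀ D : ℂ → LInfty.Codiff (ZMod 2), LInfty.IsDeformation d.forget D →
        ∃ E : ℂ → LInfty.Codiff ℤ, LInfty.IsDeformation d E ∧
          ∀ᶠ t in 𝓝 (0 : ℂ), (E t).forget.Equivalent (D t)) ∧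
      (∀ d' : LInfty.Codiff ℤ, LInfty.HasJump d d' ↔ LInfty.HasJump d.forget d'.forget)) := by
  refine ⟨LInfty.moduliMap_bijective, fun k d hd => d.exists_linearAut hd, ?_, fun d => ⟨?_, ?_, ?_⟩⟩
  · intro k _ d hd _ hdeg h0 g hlin hg
    obtain ⟨hiff, hstr⟩ := LInfty.hasDegree_pull_linear hd hdeg h0 hlin hg
    refine ⟨hiff, fun h => ⟨(LInfty.straighten g).trans g,
      hlin.trans (LInfty.isLinearAut_straighten hlin), (hstr (hiff.mp h)).1,
      fun m hm => LInfty.entry_straighten_trans (hiff.mp h) hm, (hstr (hiff.mp h)).2⟩⟩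
  · exact fun E hE => ⟨hE.forget, LInfty.isSmoothFamily_forget_iff E,
      LInfty.factorsThroughJump_forget_iff d E⟩
  · exact fun D hD => hD.exists_int
  · exact LInfty.hasJump_forget_iff d
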